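/- A graphon is a symmetric measurable function $g:[0,1]^2\to[0,1]$. Put $$\varepsilon(g)=\int_{[0,1]^2} g\,dx\,dy,\qquad \tau(g)=\int_{[0,1]^3} g(x,y)g(y,z)g(z,x)\,dx\,dy\,dz,$$ $$S(g)=-\tfrac12\int_{[0,1]^2} \bigl(g\ln g+(1-g)\ln(1-g)\bigr)\,dx\,dy .$$ An optimizer at $(\varepsilon,\tau)$ is a graphon that maximizes $S$ among all graphons with edge density $\varepsilon$ and triangle density $\tau$. Reduced graphons are graphons up to rearrangement, with the cut metric $\delta(f,g)=\inf_\phi \sup_{S,T}\bigl|\int_{S\times T}(f(x,y)-g(\phi(x),\phi(y)))\,dx\,dy\bigr|$, where $S,T\subseteq[0,1]$ are measurable and $\phi$ ranges over the invertible measure-preserving maps of $[0,1]$; graphons at distance $0$ are identified. A graphon is of type $B(1,1)$ if, up to rearrangement, it is constant on the blocks of a partition of $[0,1]$ into two sets (podes) of sizes $c,1-c$ with $0<c<1$, with values $p_{11}=a$, $p_{22}=b$, $p_{12}=p_{21}=d$, and it is neither constant ($a=b=d$) nor symmetric under exchange of the podes ($a=b$ and $c=\frac12$). It is of type $B(2,1)$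 or $C(1,2)$ (the same class of graphons) if it is given in this way by three podes of sizes $\frac c2,\frac c2,1-c$ with $0<c<1$, and values $p_{11}=p_{22}=a_-$, $p_{12}=p_{21}=a_+$, $p_{13}=p_{31}=p_{23}=p_{32}=d$, $p_{33}=b$, where $a_+\neq a_-$, and the three podes are not all interchangeable (that is, not both $c=\frac23$ and $b=a_-,\ d=a_+$). A $B(1,1)$ phase (respectively a $B(2,1)$ or $C(1,2)$ phase) is a nonempty connected open set of points $(\varepsilon,\tau)$ with $\tau<\varepsilon^3$ at each of which the optimizer is unique as a reduced graphon and is of type $B(1,1)$ (respectively of type $B(2,1)$ or $C(1,2)$), and on which the optimizer varies analytically, i.e. the values and pode sizes can be chosen, locally, as real-analytic functions of $(\varepsilon,\tau)$. There is a continuous transition at $(\varepsilon_0,\tau_0)$ from a $B(1,1)$ phase $U$ to a $B(2,1)$ or $C(1,2)$ phase $V$ if some graphon $g_0$ of type $B(1,1)$ is the cut-metric limit both of optimizers at a sequence of points of $U$ tending to $(\varepsilon_0,\tau_0)$ and of optimizers at a sequence of points of $V$ tending to $(\varepsilon_0,\tau_0)$. Theorem. There is a finite set $E\subset\mathbb R$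 such that, for every $\varepsilon_0\notin E$ and every $\tau_0$, there is no continuous transition at $(\varepsilon_0,\tau_0)$ from a $B(1,1)$ phase to a $B(2,1)$ or $C(1,2)$ phase. -/

import Mathlib

open MeasureTheory Filter Topology unitInterval

noncomputable section

namespace EdgeTriangle

/-- A graphon: a symmetric measurable function `[0,1]² → [0,1]`. -/
structure IsGraphon (g : I → I → ℝ) : Prop where
  measurable : Measurable (Function.uncurry g)
  symm : ∀ x y, g x y = g y x
  mem_Icc : ∀ x y, g x y ∈ Set.Icc (0 : ℝ) 1

/-- The edge density `ε(g) = ∫ g(x,y) dx dy`. -/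
def edgeDensity (g : I → I → ℝ) : ℝ :=
  ∫ x, ∫ y, g x y

/-- The triangle density `τ(g) = ∫ g(x,y) g(y,z) g(z,x) dx dy dz`. -/
def triangleDensity (g : I → I → ℝ) : ℝ :=
  ∫ x, ∫ y, ∫ z, g x y * g y z * g z x

/-- The graphon entropy
`S(g) = -½ ∫ g log g + (1 - g) log (1 - g) dx dy`, with `0 log 0 = 0`. -/
def entropy (g : I → I → ℝ) : ℝ :=
  -(1 / 2) * ∫ x, ∫ y, (g x y * Real.log (g x y) + (1 - g x y) * Real.log (1 - g x y))

/-- The labelled cut metric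
`d(f,g) = sup_{S,T} |∫_{S × T} (f - g)|`, over measurable `S, T ⊆ [0,1]`. -/
def labelledCutDist (f g : I → I → ℝ) : ℝ :=
  sSup {r : ℝ | ∃ S T : Set I, MeasurableSet S ∧ MeasurableSet T ∧
    r = |∫ x in S, ∫ y in T, (f x y - g x y)|}

/-- The cut metric on reduced graphons: the infimum of the labelled cut metric over all
rearrangements of `[0,1]` by invertible measure-preserving maps. -/
def cutDist (f g : I → I → ℝ) : ℝ :=
  ⨅ φ : {φ : I ≃ᵐ I // MeasurePreserving φ volume volume},
    labelledCutDist f (fun x y => g (φ.1 x) (φ.1 y))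

/-- Two graphons represent the same reduced graphon iff their cut distance vanishes. -/
def Equivalent (f g : I → I → ℝ) : Prop :=
  cutDist f g = 0

/-- `g` maximizes the entropy among all graphons with edge density `p.1` and triangle
density `p.2`. -/
structure IsOptimizer (p : ℝ × ℝ) (g : I → I → ℝ) : Prop where
  isGraphon : IsGraphon g
  edge : edgeDensity g = p.1
  triangle : triangleDensity g = p.2
  maximal : ∀ h, IsGraphon h → edgeDensity h = p.1 → triangleDensity h = p.2 →
    entropy h ≤ entropy g

/-- `g` is the optimizer at `p = (ε, τ)`, unique as a reduced graphon. -/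
def IsUniqueOptimizer (p : ℝ × ℝ) (g : I → I → ℝ) : Prop :=
  IsOptimizer p g ∧ ∀ h, IsOptimizer p h → Equivalent h g

/-- The bipodal graphon with podes `[0,c)` and `[c,1]`, and
`p₁₁ = a`, `p₂₂ = b`, `p₁₂ = p₂₁ = d`. -/
def bipodal (a b c d : ℝ) : I → I → ℝ := fun x y =>
  if (x : ℝ) < c then
    if (y : ℝ) < c then a else d
  else
    if (y : ℝ) < c then d else b

/-- The tripodal graphon with podes `[0,c/2)`, `[c/2,c)` and `[c,1]`, and
`p₁₁ = p₂₂ = am`, `p₁₂ = p₂₁ = ap`, `p₃₃ = b`, and `d` for the remaining entries. -/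
def tripodal (ap am b c d : ℝ) : I → I → ℝ := fun x y =>
  if (x : ℝ) < c then
    if (y : ℝ) < c then
      if ((x : ℝ) < c / 2 ↔ (y : ℝ) < c / 2) then am else ap
    else d
  else
    if (y : ℝ) < c then d else b

/-- The parameters describe a bipodal graphon of type `B(1,1)`: two podes of positive size
which are neither indistinguishable (a constant graphon) nor interchangeable (type `A(2,0)`). -/
structure IsB11 (a b c d : ℝ) : Prop where
  a_mem : a ∈ Set.Icc (0 : ℝ) 1
  b_mem : b ∈ Set.Icc (0 : ℝ) 1
  c_mem : c ∈ Set.Ioo (0 : ℝ) 1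
  d_mem : d ∈ Set.Icc (0 : ℝ) 1
  not_constant : ¬ (a = d ∧ b = d)
  not_A20 : ¬ (a = b ∧ c = 1 / 2)

/-- The parameters describe a tripodal graphon of type `B(2,1)` or `C(1,2)`. These are the same
class of graphons: three different podes, of which exactly two are interchangeable. When
`ap = am` the first two podes merge into one, and the last condition excludes that all three
podes are interchangeable (type `A(3,0)`). -/
structure IsB21orC12 (ap am b c d : ℝ) : Prop where
  ap_mem : ap ∈ Set.Icc (0 : ℝ) 1
  am_mem : am ∈ Set.Icc (0 : ℝ) 1
  b_mem : b ∈ Set.Icc (0 : ℝ) 1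
  c_mem : c ∈ Set.Ioo (0 : ℝ) 1
  d_mem : d ∈ Set.Icc (0 : ℝ) 1
  ne : ap ≠ am
  not_A30 : ¬ (c = 2 / 3 ∧ b = am ∧ d = ap)

/-- A `B(1,1)` phase: a connected open set of points `(ε, τ)` below the Erdős–Rényi curve
`τ = ε³` at which the optimal reduced graphon is unique, is of type `B(1,1)`, and varies
analytically with `(ε, τ)`. -/
structure IsB11Phase (U : Set (ℝ × ℝ)) : Prop where
  isOpen : IsOpen U
  isConnected : IsConnected U
  below : ∀ p ∈ U, p.2 < p.1 ^ 3
  optimal : ∀ p ∈ U, ∃ a b c d : ℝ × ℝ → ℝ,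
    AnalyticAt ℝ a p ∧ AnalyticAt ℝ b p ∧ AnalyticAt ℝ c p ∧ AnalyticAt ℝ d p ∧
    ∀ᶠ q in 𝓝 p, IsB11 (a q) (b q) (c q) (d q) ∧
      IsUniqueOptimizer q (bipodal (a q) (b q) (c q) (d q))

/-- A `B(2,1)` or `C(1,2)` phase: a connected open set of points `(ε, τ)` below the
Erdős–Rényi curve `τ = ε³` at which the optimal reduced graphon is unique, is tripodal with
exactly two interchangeable podes, and varies analytically with `(ε, τ)`. -/
structure IsB21orC12Phase (V : Set (ℝ × ℝ)) : Prop where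
  isOpen : IsOpen V
  isConnected : IsConnected V
  below : ∀ p ∈ V, p.2 < p.1 ^ 3
  optimal : ∀ p ∈ V, ∃ ap am b c d : ℝ × ℝ → ℝ,
    AnalyticAt ℝ ap p ∧ AnalyticAt ℝ am p ∧ AnalyticAt ℝ b p ∧ AnalyticAt ℝ c p ∧
    AnalyticAt ℝ d p ∧
    ∀ᶠ q in 𝓝 p, IsB21orC12 (ap q) (am q) (b q) (c q) (d q) ∧
      IsUniqueOptimizer q (tripodal (ap q) (am q) (b q) (c q) (d q))

/-- `g₀` is a limit, in the cut metric, of optimizers at points of `U` that tend to `p₀`. -/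
def IsLimitOfOptimizers (U : Set (ℝ × ℝ)) (p₀ : ℝ × ℝ) (g₀ : I → I → ℝ) : Prop :=
  ∃ (p : ℕ → ℝ × ℝ) (g : ℕ → I → I → ℝ),
    (∀ n, p n ∈ U) ∧ (∀ n, IsOptimizer (p n) (g n)) ∧
    Tendsto p atTop (𝓝 p₀) ∧ Tendsto (fun n => cutDist (g n) g₀) atTop (𝓝 0)

/-- At `p₀` there is a continuous transition from the `B(1,1)` phase `U` to the phase `V`: some
graphon of type `B(1,1)` can be approached by optimizers both from inside `U` and from inside
`V`, as `(ε, τ) → p₀`. Approach along one sequence on each side is enough, so this holds as soon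
as the optimizer does not jump at `p₀` along some path that leads from `U` to `V`. -/
def IsContinuousTransition (U V : Set (ℝ × ℝ)) (p₀ : ℝ × ℝ) : Prop :=
  ∃ a b c d : ℝ, IsB11 a b c d ∧
    IsLimitOfOptimizers U p₀ (bipodal a b c d) ∧ IsLimitOfOptimizers V p₀ (bipodal a b c d)

end EdgeTriangle

end

/-!
Let tripodal optimizers with values `am ≠ ap` on the blocks of their interchangeable podes converge
to a bipodal graphon. The limit forces these two podes to merge, so that `am - ap → 0`, and the
Euler–Lagrange equations on the diagonal and off-diagonal blocks give
`log (1 / am - 1) - log (1 / ap - 1) = 3 β c (am - ap) ^ 2`, where `β` is the Lagrange multiplier of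
the triangle density. Dividing by `am - ap` shows that `β → ∞`. In the limit the Euler–Lagrange
equations therefore lose their entropy term: the codegrees of all blocks with values in `(0, 1)`
agree, and an infinitesimal variation that preserves the edge density and is admissible also
preserves the triangle density.

The entropy enters again through the symmetry breaking. Splitting a pode of size `c` of the limit
into two halves, with the values `a - t` and `a + t` on the blocks, destroys `c³ t³` triangles at an
entropy cost of `O(t²)`. A path of bipodal graphons with parameter `y` along which the triangle
density is stationary creates `O(y²)` triangles, and the choice `t = M |y| ^ (2/3)` removes them for
`O(|y| ^ (4/3)) = o(y)` of entropy. Hence the entropy is stationary along every such path. A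
comparison of codegrees together with suitable paths now excludes every limit of type `B(1,1)`, so
that the exceptional set of edge densities is empty.
-/

noncomputable section

namespace EdgeTriangle

/-! ### Step graphons -/

/-- The kernel on `[0,1]²` that takes the value `v i j` on the block of the podes
`q ⁻¹' {i}` and `q ⁻¹' {j}`: a partition into podes is encoded by the map `q` that sends a point
to the label of its pode. -/
def step {ι : Type*} (q : I → ι) (v : ι → ι → ℝ) : I → I → ℝ := fun x y => v (q x) (q y)

/-- The size of each pode of the partition encoded by `q`. -/
def podeWeight {ι : Type*} (q : I → ι) (i : ι) : ℝ := volume.real (q ⁻¹' {i})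

lemma podeWeight_nonneg {ι : Type*} (q : I → ι) (i : ι) : 0 ≤ podeWeight q i := measureReal_nonneg

section Step

variable {ι : Type*} [Fintype ι]

/-- The edge density of a step graphon with pode sizes `w` and values `v`. -/
def stepEdge (w : ι → ℝ) (v : ι → ι → ℝ) : ℝ := ∑ i, ∑ j, w i * w j * v i j

/-- The triangle density of a step graphon with pode sizes `w` and values `v`. -/
def stepTriangle (w : ι → ℝ) (v : ι → ι → ℝ) : ℝ :=
  ∑ i, ∑ j, ∑ k, w i * w j * w k * (v i j * v j k * v k i)

/-- The entropy of a step graphon with pode sizes `w` and values `v`. -/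
def stepEntropy (w : ι → ℝ) (v : ι → ι → ℝ) : ℝ :=
  (∑ i, ∑ j, w i * w j * Real.binEntropy (v i j)) / 2

/-- The density of common neighbours of a vertex in pode `i` and a vertex in pode `j`. -/
def codegree (w : ι → ℝ) (v : ι → ι → ℝ) (i j : ι) : ℝ := ∑ k, w k * (v i k * v k j)

variable [MeasurableSpace ι] [MeasurableSingletonClass ι] {q : I → ι}

lemma integral_comp_pode (hq : Measurable q) (f : ι → ℝ) :
    ∫ x, f (q x) = ∑ i, podeWeight q i * f i := by
  have : IsFiniteMeasure (Measure.map q volume) := Measure.isFiniteMeasure_map _ _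
  rw [← integral_map (f := f) hq.aemeasurable (measurable_of_finite f).aestronglyMeasurable,
    integral_fintype .of_finite]
  simp only [map_measureReal_apply hq (MeasurableSet.singleton _), podeWeight, smul_eq_mul]

lemma sum_podeWeight (hq : Measurable q) : ∑ i, podeWeight q i = 1 := by
  simpa using (integral_comp_pode hq fun _ => 1).symm

lemma integral_integral_step (hq : Measurable q) (v : ι → ι → ℝ) :
    ∫ x, ∫ y, v (q x) (q y) = ∑ i, ∑ j, podeWeight q i * podeWeight q j * v i j := by
  simp_rw [integral_comp_pode hq (v _), mul_assoc, ← Finset.mul_sum]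
  exact integral_comp_pode hq fun i => ∑ j, podeWeight q j * v i j

lemma edgeDensity_step (hq : Measurable q) (v : ι → ι → ℝ) :
    edgeDensity (step q v) = stepEdge (podeWeight q) v :=
  integral_integral_step hq v

lemma triangleDensity_step (hq : Measurable q) (v : ι → ι → ℝ) :
    triangleDensity (step q v) = stepTriangle (podeWeight q) v := by
  simp_rw [triangleDensity, step, fun x y => integral_comp_pode hq fun k =>
    v (q x) (q y) * v (q y) k * v k (q x)]
  rw [integral_integral_step hq fun i j => ∑ k, podeWeight q k * (v i j * v j k * v k i)]
  simp only [stepTriangle, Finset.mul_sum, mul_assoc]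

lemma entropy_step (hq : Measurable q) (v : ι → ι → ℝ) :
    entropy (step q v) = stepEntropy (podeWeight q) v := by
  simp only [entropy, step]
  rw [integral_integral_step hq fun i j => v i j * Real.log (v i j) +
    (1 - v i j) * Real.log (1 - v i j), stepEntropy, Finset.mul_sum, Finset.sum_div]
  refine Finset.sum_congr rfl fun i _ => ?_
  rw [Finset.mul_sum, Finset.sum_div]
  refine Finset.sum_congr rfl fun j _ => ?_
  rw [Real.binEntropy, Real.log_inv, Real.log_inv]
  ring

end Step

lemma isGraphon_step {ι : Type*} [Finite ι] [MeasurableSpace ι] [MeasurableSingletonClass ι]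
    {q : I → ι} (hq : Measurable q) {v : ι → ι → ℝ} (hsymm : ∀ i j, v i j = v j i)
    (hmem : ∀ i j, v i j ∈ Set.Icc (0 : ℝ) 1) : IsGraphon (step q v) where
  measurable := (measurable_of_finite (Function.uncurry v)).comp
    ((hq.comp measurable_fst).prodMk (hq.comp measurable_snd))
  symm _ _ := hsymm _ _
  mem_Icc _ _ := hmem _ _

/-! ### Binary entropy -/

/-- The derivative `log (1 - u) - log u` of the binary entropy at `u`. -/
def entropySlope (u : ℝ) : ℝ := Real.log (1 - u) - Real.log u

lemma hasDerivAt_binEntropy {u : ℝ} (hu : u ∈ Set.Ioo (0 : ℝ) 1) :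
    HasDerivAt Real.binEntropy (entropySlope u) u :=
  Real.hasDerivAt_binEntropy hu.1.ne' hu.2.ne

lemma continuousAt_entropySlope {u : ℝ} (hu : u ∈ Set.Ioo (0 : ℝ) 1) :
    ContinuousAt entropySlope u := by
  have hu₀ : u ≠ 0 := hu.1.ne'
  have hu₁ : 1 - u ≠ 0 := (sub_pos.2 hu.2).ne'
  unfold entropySlope
  fun_prop (disch := assumption)

lemma sub_le_entropySlope_sub {x y : ℝ} (hx : 0 < x) (hxy : x ≤ y) (hy : y < 1) :
    y - x ≤ entropySlope x - entropySlope y := by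
  have hy₀ : 0 < y := hx.trans_le hxy
  have hlog_one_sub : Real.log (1 - y) ≤ Real.log (1 - x) :=
    Real.log_le_log (by linarith) (by linarith)
  have hlog := Real.log_le_sub_one_of_pos (div_pos hx hy₀)
  rw [Real.log_div hx.ne' hy₀.ne'] at hlog
  have hdiv : y - x ≤ 1 - x / y := by
    rw [one_sub_div hy₀.ne', le_div_iff₀ hy₀]
    nlinarith
  unfold entropySlope
  linarith

lemma sq_sub_le_entropySlope_sub_mul {x y : ℝ} (hx : x ∈ Set.Ioo (0 : ℝ) 1)
    (hy : y ∈ Set.Ioo (0 : ℝ) 1) :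
    (x - y) ^ 2 ≤ (entropySlope x - entropySlope y) * (y - x) := by
  rcases le_total x y with h | h
  · nlinarith [sub_le_entropySlope_sub hx.1 h hy.2]
  · nlinarith [sub_le_entropySlope_sub hy.1 h hx.2]

lemma binEntropy_le_three_mul_sqrt {u : ℝ} (hu : u ∈ Set.Icc (0 : ℝ) 1) :
    Real.binEntropy u ≤ 3 * √u := by
  rcases hu.1.eq_or_lt with rfl | hu₀
  · simp
  have hlog_one_sub : Real.negMulLog (1 - u) ≤ u := by
    simpa using Real.negMulLog_le_one_sub_self (sub_nonneg.2 hu.2)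
  have hle_sqrt : u ≤ √u := Real.le_sqrt_of_sq_le (by nlinarith [hu.2])
  have hlog : Real.negMulLog u ≤ 2 * √u := by
    have h := (abs_lt.1 (Real.abs_log_mul_self_rpow_lt u (1 / 2) hu₀ hu.2 (by norm_num))).1
    rw [← Real.sqrt_eq_rpow] at h
    calc Real.negMulLog u = -(Real.log u * √u) * √u := by
          rw [Real.negMulLog]
          linear_combination Real.log u * Real.mul_self_sqrt hu.1
      _ ≤ 2 * √u := mul_le_mul_of_nonneg_right (by linarith) (Real.sqrt_nonneg u)
  rw [Real.binEntropy_eq_negMulLog_add_negMulLog_one_sub]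
  linarith

lemma neg_mul_log_le_binEntropy {u : ℝ} (hu : u ∈ Set.Icc (0 : ℝ) 1) :
    -(u * Real.log u) ≤ Real.binEntropy u := by
  rw [Real.binEntropy_eq_negMulLog_add_negMulLog_one_sub, ← neg_mul]
  exact le_add_of_nonneg_right (Real.negMulLog_nonneg (sub_nonneg.2 hu.2) (sub_le_self _ hu.1))

lemma concaveOn_binEntropy : ConcaveOn ℝ (Set.Icc 0 1) Real.binEntropy :=
  Real.strictConcave_binEntropy.concaveOn

/-! ### Monotonicity of the maximal entropy below the Erdős–Rényi curve -/

/-- The block values `v` moved the fraction `s` of the way to the constant `e`. -/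
def mixing {ι : Type*} (v : ι → ι → ℝ) (e s : ℝ) : ι → ι → ℝ := fun i j => (1 - s) * v i j + s * e

@[simp]
lemma mixing_zero {ι : Type*} (v : ι → ι → ℝ) (e : ℝ) : mixing v e 0 = v := by
  ext; simp [mixing]

lemma mixing_mem {ι : Type*} {v : ι → ι → ℝ} {e s : ℝ}
    (hv : ∀ i j, v i j ∈ Set.Icc (0 : ℝ) 1) (he : e ∈ Set.Icc (0 : ℝ) 1)
    (hs : s ∈ Set.Icc (0 : ℝ) 1) (i j : ι) :
    mixing v e s i j ∈ Set.Icc (0 : ℝ) 1 :=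
  convex_Icc (0 : ℝ) 1 (hv i j) he (sub_nonneg.2 hs.2) hs.1 (sub_add_cancel 1 s)

section Mixing

variable {ι : Type*} [Fintype ι] {w : ι → ℝ} {v : ι → ι → ℝ}

lemma sum_mul_weights (hw : ∑ i, w i = 1) : ∑ i, ∑ j, w i * w j = 1 := by
  rw [← Fintype.sum_mul_sum, hw, one_mul]

lemma stepEdge_mem (hw₀ : ∀ i, 0 ≤ w i) (hw : ∑ i, w i = 1)
    (hv : ∀ i j, v i j ∈ Set.Icc (0 : ℝ) 1) : stepEdge w v ∈ Set.Icc (0 : ℝ) 1 := by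
  have hww i j : 0 ≤ w i * w j := mul_nonneg (hw₀ i) (hw₀ j)
  refine ⟨Finset.sum_nonneg fun i _ => Finset.sum_nonneg fun j _ =>
    mul_nonneg (hww i j) (hv i j).1, ?_⟩
  rw [← sum_mul_weights hw]
  exact Finset.sum_le_sum fun i _ => Finset.sum_le_sum fun j _ =>
    mul_le_of_le_one_right (hww i j) (hv i j).2

lemma stepEntropy_le_binEntropy_stepEdge (hw₀ : ∀ i, 0 ≤ w i) (hw : ∑ i, w i = 1)
    (hv : ∀ i j, v i j ∈ Set.Icc (0 : ℝ) 1) :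
    stepEntropy w v ≤ Real.binEntropy (stepEdge w v) / 2 := by
  have hjensen := concaveOn_binEntropy.le_map_sum (t := Finset.univ)
    (w := fun k : ι × ι => w k.1 * w k.2) (p := fun k => v k.1 k.2)
    (fun k _ => mul_nonneg (hw₀ k.1) (hw₀ k.2))
    (by rw [Fintype.sum_prod_type, sum_mul_weights hw]) (fun k _ => hv k.1 k.2)
  simp only [Fintype.sum_prod_type, smul_eq_mul] at hjensen
  exact div_le_div_of_nonneg_right hjensen zero_le_two

lemma stepEdge_mixing (hw : ∑ i, w i = 1) (e s : ℝ) :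
    stepEdge w (mixing v e s) = (1 - s) * stepEdge w v + s * e := by
  calc stepEdge w (mixing v e s)
      = ∑ i, ∑ j, ((1 - s) * (w i * w j * v i j) + s * e * (w i * w j)) :=
        Finset.sum_congr rfl fun i _ => Finset.sum_congr rfl fun j _ => by rw [mixing]; ring
    _ = (1 - s) * stepEdge w v + s * e := by
        simp only [Finset.sum_add_distrib, ← Finset.mul_sum, hw, stepEdge, mul_one]

lemma stepTriangle_mixing_one (hw : ∑ i, w i = 1) (e : ℝ) :
    stepTriangle w (mixing v e 1) = e ^ 3 := by
  simp only [stepTriangle, mixing, sub_self, zero_mul, one_mul, zero_add, ← Finset.sum_mul,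
    ← Finset.mul_sum, hw, mul_one]
  ring

lemma mul_stepEntropy_le_stepEntropy_mixing (hw₀ : ∀ i, 0 ≤ w i) (hw : ∑ i, w i = 1)
    (hv : ∀ i j, v i j ∈ Set.Icc (0 : ℝ) 1) {e s : ℝ} (he : e ∈ Set.Icc (0 : ℝ) 1)
    (hs : s ∈ Set.Icc (0 : ℝ) 1) :
    (1 - s) * stepEntropy w v + s * (Real.binEntropy e / 2) ≤ stepEntropy w (mixing v e s) := by
  have hconcave i j : (1 - s) * Real.binEntropy (v i j) + s * Real.binEntropy e ≤
      Real.binEntropy (mixing v e s i j) :=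
    concaveOn_binEntropy.2 (hv i j) he (sub_nonneg.2 hs.2) hs.1 (sub_add_cancel 1 s)
  calc (1 - s) * stepEntropy w v + s * (Real.binEntropy e / 2)
      = (∑ i, ∑ j, w i * w j *
          ((1 - s) * Real.binEntropy (v i j) + s * Real.binEntropy e)) / 2 := by
        simp only [mul_add, Finset.sum_add_distrib, ← Finset.sum_mul, stepEntropy,
          mul_left_comm _ (1 - s), ← Finset.mul_sum, hw, mul_one]
        ring
    _ ≤ stepEntropy w (mixing v e s) := by
        refine div_le_div_of_nonneg_right ?_ zero_le_two
        exact Finset.sum_le_sum fun i _ => Finset.sum_le_sum fun j _ =>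
          mul_le_mul_of_nonneg_left (hconcave i j) (mul_nonneg (hw₀ i) (hw₀ j))

lemma stepEntropy_add_le_stepEntropy_mixing_half (hw₀ : ∀ i, 0 ≤ w i)
    (hv : ∀ i j, v i j ∈ Set.Icc (0 : ℝ) 1) {i j : ι} (hij : v i j = 0 ∨ v i j = 1) {t : ℝ}
    (ht : t ∈ Set.Icc (0 : ℝ) 1) :
    stepEntropy w v + w i * w j * Real.binEntropy (t / 2) / 2 ≤
      stepEntropy w (mixing v (1 / 2) t) := by
  let gain : ι × ι → ℝ := fun k => w k.1 * w k.2 *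
    (Real.binEntropy (mixing v (1 / 2) t k.1 k.2) - Real.binEntropy (v k.1 k.2))
  have hgain k : 0 ≤ gain k := by
    refine mul_nonneg (mul_nonneg (hw₀ _) (hw₀ _)) (sub_nonneg.2 ?_)
    have hmax : Real.binEntropy (v k.1 k.2) ≤ Real.binEntropy (1 / 2) := by
      simpa using Real.binEntropy_le_log_two (p := v k.1 k.2)
    refine le_trans ?_ (concaveOn_binEntropy.2 (hv k.1 k.2)
      (⟨by norm_num, by norm_num⟩ : (1 / 2 : ℝ) ∈ Set.Icc 0 1) (sub_nonneg.2 ht.2) ht.1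
      (sub_add_cancel 1 t))
    simp only [smul_eq_mul]
    linarith [mul_le_mul_of_nonneg_left hmax ht.1]
  have hgain_ij : gain (i, j) = w i * w j * Real.binEntropy (t / 2) := by
    have hv_entropy : Real.binEntropy (v i j) = 0 := by rcases hij with h | h <;> simp [h]
    have hmix_entropy : Real.binEntropy (mixing v (1 / 2) t i j) = Real.binEntropy (t / 2) := by
      rcases hij with h | h
      · congr 1; simp only [mixing, h]; ring
      · rw [← Real.binEntropy_one_sub]; congr 1; simp only [mixing, h]; ring
    simp only [gain, hv_entropy, hmix_entropy, sub_zero]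
  have hsum : stepEntropy w (mixing v (1 / 2) t) - stepEntropy w v = (∑ k, gain k) / 2 := by
    simp only [stepEntropy, gain, Fintype.sum_prod_type, mul_sub, Finset.sum_sub_distrib, sub_div]
  have hsingle := Finset.single_le_sum (f := gain) (fun k _ => hgain k) (Finset.mem_univ (i, j))
  linarith

variable [MeasurableSpace ι] [MeasurableSingletonClass ι]

/- Mixing the competitor with the constant graphon of the same edge density raises the entropy and,
by the intermediate value theorem, can restore the triangle density. -/
lemma IsOptimizer.stepEntropy_le_entropy {p : ℝ × ℝ} {g : I → I → ℝ} (hg : IsOptimizer p g)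
    (hp : p.2 ≤ p.1 ^ 3) {q : I → ι} (hq : Measurable q) (hsymm : ∀ i j, v i j = v j i)
    (hv : ∀ i j, v i j ∈ Set.Icc (0 : ℝ) 1) (hedge : stepEdge (podeWeight q) v = p.1)
    (htriangle : stepTriangle (podeWeight q) v ≤ p.2) :
    stepEntropy (podeWeight q) v ≤ entropy g := by
  have hw₀ := podeWeight_nonneg q
  have hw := sum_podeWeight hq
  have he : p.1 ∈ Set.Icc (0 : ℝ) 1 := hedge ▸ stepEdge_mem hw₀ hw hv
  have hcont : Continuous fun s => stepTriangle (podeWeight q) (mixing v p.1 s) := by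
    simp only [stepTriangle, mixing]
    fun_prop
  obtain ⟨s, hs, hs_triangle⟩ := intermediate_value_Icc zero_le_one hcont.continuousOn
    ⟨by simpa only [mixing_zero] using htriangle,
      hp.trans_eq (stepTriangle_mixing_one hw p.1).symm⟩
  have hmax := hg.maximal (step q (mixing v p.1 s))
    (isGraphon_step hq (fun i j => by rw [mixing, mixing, hsymm]) (mixing_mem hv he hs))
    (by rw [edgeDensity_step hq, stepEdge_mixing hw, hedge]; ring)
    (by rw [triangleDensity_step hq]; exact hs_triangle)
  rw [entropy_step hq] at hmax
  have hjensen := stepEntropy_le_binEntropy_stepEdge hw₀ hw hv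
  rw [hedge] at hjensen
  calc stepEntropy (podeWeight q) v
      ≤ (1 - s) * stepEntropy (podeWeight q) v + s * (Real.binEntropy p.1 / 2) := by
        nlinarith [mul_le_mul_of_nonneg_left hjensen hs.1]
    _ ≤ stepEntropy (podeWeight q) (mixing v p.1 s) :=
        mul_stepEntropy_le_stepEntropy_mixing hw₀ hw hv he hs
    _ ≤ entropy g := hmax

end Mixing

/-! ### Optimizers in a phase take values in the open unit interval -/

lemma isBigO_sq_of_isLocalMin {E : Type*} [NormedAddCommGroup E] [NormedSpace ℝ E]
    {u : E → ℝ} {p : E} (hu : AnalyticAt ℝ u p) (hmin : IsLocalMin u p) :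
    (fun q => u q - u p) =O[𝓝 p] fun q => ‖q - p‖ ^ 2 := by
  obtain ⟨f, hf⟩ := hu
  have hlinear : ∀ y, f 1 (fun _ => y) = 0 := fun y => by
    have h := hf.fderiv_eq
    rw [hmin.fderiv_eq_zero] at h
    simpa [Matrix.vec_single_eq_const] using (DFunLike.congr_fun h y).symm
  have hconst : ∀ y, f 0 (fun _ => y) = u p := fun y => hf.coeff_zero _
  have htaylor := (hf.isBigO_sub_partialSum_pow 2).comp_tendsto
    (show Tendsto (fun q => q - p) (𝓝 p) (𝓝 0) from
      Continuous.tendsto' (by fun_prop) _ _ (sub_self p))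
  simpa [Function.comp_def, FormalMultilinearSeries.partialSum, Finset.sum_range_succ, hlinear,
    hconst] using htaylor

lemma isBigO_binEntropy_comp_of_eq_zero {E : Type*} [NormedAddCommGroup E] [NormedSpace ℝ E]
    {u : E → ℝ} {p : E} (hu : AnalyticAt ℝ u p) (hmem : ∀ᶠ q in 𝓝 p, u q ∈ Set.Icc (0 : ℝ) 1)
    (hp : u p = 0) : (fun q => Real.binEntropy (u q)) =O[𝓝 p] fun q => q - p := by
  have hmin : IsLocalMin u p := hmem.mono fun q hq => hp ▸ hq.1
  obtain ⟨C, hC⟩ := (isBigO_sq_of_isLocalMin hu hmin).bound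
  refine Asymptotics.IsBigO.of_bound (3 * √C) ?_
  filter_upwards [hC, hmem] with q hq hq_mem
  rw [hp, sub_zero, norm_pow, norm_norm, Real.norm_eq_abs] at hq
  rw [Real.norm_of_nonneg (Real.binEntropy_nonneg hq_mem.1 hq_mem.2)]
  calc Real.binEntropy (u q) ≤ 3 * √(u q) := binEntropy_le_three_mul_sqrt hq_mem
    _ ≤ 3 * √(C * ‖q - p‖ ^ 2) := by gcongr; exact (le_abs_self _).trans hq
    _ = 3 * √C * ‖q - p‖ := by
      rw [Real.sqrt_mul' _ (sq_nonneg _), Real.sqrt_sq (norm_nonneg _), mul_assoc]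

/- The entropy has infinite slope at `0` and `1`, but an analytic function with values in `[0,1]`
vanishes quadratically where it vanishes. -/
lemma isBigO_binEntropy_comp_sub {E : Type*} [NormedAddCommGroup E] [NormedSpace ℝ E]
    {u : E → ℝ} {p : E} (hu : AnalyticAt ℝ u p) (hmem : ∀ᶠ q in 𝓝 p, u q ∈ Set.Icc (0 : ℝ) 1) :
    (fun q => Real.binEntropy (u q) - Real.binEntropy (u p)) =O[𝓝 p] fun q => q - p := by
  rcases hmem.self_of_nhds.1.eq_or_lt with h₀ | h₀
  · simpa [← h₀] using isBigO_binEntropy_comp_of_eq_zero hu hmem h₀.symm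
  rcases hmem.self_of_nhds.2.eq_or_lt with h₁ | h₁
  · have hmem' : ∀ᶠ q in 𝓝 p, 1 - u q ∈ Set.Icc (0 : ℝ) 1 :=
      hmem.mono fun q hq => ⟨sub_nonneg.2 hq.2, sub_le_self _ hq.1⟩
    simpa [h₁] using
      isBigO_binEntropy_comp_of_eq_zero (analyticAt_const.sub hu) hmem' (by simp [h₁])
  · exact ((hasDerivAt_binEntropy ⟨h₀, h₁⟩).differentiableAt.comp p
      hu.differentiableAt).isBigO_sub

/-- A family of step graphons, with pode partitions `Q q` and values `v q`, that consists of
optimizers at all `q` near `p` and varies smoothly at `p`. -/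
structure IsOptimalStepFamily {ι : Type*} [MeasurableSpace ι] (Q : ℝ × ℝ → I → ι)
    (v : ℝ × ℝ → ι → ι → ℝ) (p : ℝ × ℝ) : Prop where
  measurable : ∀ q, Measurable (Q q)
  symm : ∀ q i j, v q i j = v q j i
  mem_Icc : ∀ᶠ q in 𝓝 p, ∀ i j, v q i j ∈ Set.Icc (0 : ℝ) 1
  weight_pos : ∀ i, 0 < podeWeight (Q p) i
  analyticAt_value : ∀ i j, AnalyticAt ℝ (fun q => v q i j) p
  differentiableAt_weight : ∀ i, DifferentiableAt ℝ (fun q => podeWeight (Q q) i) p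
  isOptimizer : ∀ᶠ q in 𝓝 p, IsOptimizer q (step (Q q) (v q))

namespace IsOptimalStepFamily

variable {ι : Type*} [Fintype ι] [MeasurableSpace ι] {Q : ℝ × ℝ → I → ι}
  {v : ℝ × ℝ → ι → ι → ℝ} {p : ℝ × ℝ}

lemma isBigO_stepEntropy_sub (hF : IsOptimalStepFamily Q v p) :
    (fun q => stepEntropy (podeWeight (Q q)) (v q) - stepEntropy (podeWeight (Q p)) (v p))
      =O[𝓝 p] fun q => q - p := by
  have hblock i j : (fun q => podeWeight (Q q) i * podeWeight (Q q) j * Real.binEntropy (v q i j) -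
      podeWeight (Q p) i * podeWeight (Q p) j * Real.binEntropy (v p i j)) =O[𝓝 p]
        fun q => q - p := by
    have hweight := (hF.differentiableAt_weight i).mul (hF.differentiableAt_weight j)
    have hvalue := isBigO_binEntropy_comp_sub (hF.analyticAt_value i j)
      (hF.mem_Icc.mono fun q hq => hq i j)
    have hsum := ((hweight.continuousAt.isBigO_one ℝ).mul hvalue.norm_right).add
      ((hweight.isBigO_sub.norm_right.mul (Asymptotics.isBigO_const_const
        (Real.binEntropy (v p i j)) one_ne_zero _)).congr_right fun q => mul_comm _ _)
    refine Asymptotics.IsBigO.of_norm_right (hsum.congr (fun q => ?_) fun q => one_mul _)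
    simp only [Pi.mul_apply]
    ring
  have hsum : (fun q => 2⁻¹ * ∑ i, ∑ j,
      (podeWeight (Q q) i * podeWeight (Q q) j * Real.binEntropy (v q i j) -
        podeWeight (Q p) i * podeWeight (Q p) j * Real.binEntropy (v p i j))) =O[𝓝 p]
          fun q => q - p :=
    (Asymptotics.IsBigO.fun_sum fun i _ =>
      Asymptotics.IsBigO.fun_sum fun j _ => hblock i j).const_mul_left _
  refine hsum.congr_left fun q => ?_
  simp only [stepEntropy, Finset.sum_sub_distrib]
  ring

variable [MeasurableSingletonClass ι]

lemma eventually_entropy_le (hF : IsOptimalStepFamily Q v p) :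
    ∀ᶠ q in 𝓝 p, ∀ h, IsGraphon h → edgeDensity h = q.1 → triangleDensity h = q.2 →
      entropy h ≤ stepEntropy (podeWeight (Q q)) (v q) := by
  filter_upwards [hF.isOptimizer] with q hq h
  rw [← entropy_step (hF.measurable q)]
  exact hq.maximal h

lemma densities_eq (hF : IsOptimalStepFamily Q v p) :
    (stepEdge (podeWeight (Q p)) (v p), stepTriangle (podeWeight (Q p)) (v p)) = p := by
  rw [← edgeDensity_step (hF.measurable p), ← triangleDensity_step (hF.measurable p)]
  exact Prod.ext hF.isOptimizer.self_of_nhds.edge hF.isOptimizer.self_of_nhds.triangle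

lemma exists_eventually_stepEntropy_mixing_le (hF : IsOptimalStepFamily Q v p) :
    ∃ C, ∀ᶠ t in 𝓝[>] (0 : ℝ), stepEntropy (podeWeight (Q p)) (mixing (v p) (1 / 2) t) ≤
      stepEntropy (podeWeight (Q p)) (v p) + C * t := by
  set γ : ℝ → ℝ × ℝ := fun t => (stepEdge (podeWeight (Q p)) (mixing (v p) (1 / 2) t),
    stepTriangle (podeWeight (Q p)) (mixing (v p) (1 / 2) t)) with hγ
  have hγ_diff : Differentiable ℝ γ := by
    simp only [hγ, stepEdge, stepTriangle, mixing]
    fun_prop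
  have hγ₀ : γ 0 = p := by
    simpa only [hγ, mixing_zero] using hF.densities_eq
  have hγ_tendsto : Tendsto γ (𝓝 0) (𝓝 p) := hγ₀ ▸ hγ_diff.continuous.tendsto 0
  have hbigO := (hF.isBigO_stepEntropy_sub.comp_tendsto hγ_tendsto).trans
    (hγ₀ ▸ (hγ_diff 0).isBigO_sub)
  obtain ⟨C, hC⟩ := hbigO.bound
  refine ⟨C, ?_⟩
  filter_upwards [nhdsWithin_le_nhds hC, Ioo_mem_nhdsGT zero_lt_one,
    nhdsWithin_le_nhds (hγ_tendsto.eventually hF.eventually_entropy_le)] with t ht ht_mem hmax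
  have hle := hmax (step (Q p) (mixing (v p) (1 / 2) t))
    (isGraphon_step (hF.measurable p) (fun i j => by rw [mixing, mixing, hF.symm])
      (mixing_mem hF.mem_Icc.self_of_nhds ⟨by norm_num, by norm_num⟩ ⟨ht_mem.1.le, ht_mem.2.le⟩))
    (edgeDensity_step (hF.measurable p) _) (triangleDensity_step (hF.measurable p) _)
  rw [entropy_step (hF.measurable p)] at hle
  simp only [Function.comp_apply, sub_zero, Real.norm_eq_abs, abs_of_pos ht_mem.1] at ht
  linarith [le_abs_self (stepEntropy (podeWeight (Q (γ t))) (v (γ t)) -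
    stepEntropy (podeWeight (Q p)) (v p))]

/- Mixing with the constant `1/2` moves the densities by `O(t)`, hence the maximal entropy by
`O(t)`, but it raises the entropy of a block with value `0` or `1` by
`H(t/2) ≥ (t/2) log (2/t)`. -/
lemma value_mem_Ioo (hF : IsOptimalStepFamily Q v p) (i j : ι) :
    v p i j ∈ Set.Ioo (0 : ℝ) 1 := by
  have hmem := hF.mem_Icc.self_of_nhds
  by_contra hboundary
  have hv : v p i j = 0 ∨ v p i j = 1 := by
    by_contra! h
    exact hboundary ⟨(hmem i j).1.lt_of_ne' h.1, (hmem i j).2.lt_of_ne h.2⟩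
  obtain ⟨C, hC⟩ := hF.exists_eventually_stepEntropy_mixing_le
  have hw : 0 < podeWeight (Q p) i * podeWeight (Q p) j :=
    mul_pos (hF.weight_pos i) (hF.weight_pos j)
  have hlog : Tendsto (fun t : ℝ => -Real.log (t / 2)) (𝓝[>] 0) atTop :=
    tendsto_neg_atBot_atTop.comp (Real.tendsto_log_nhdsGT_zero.comp
      (tendsto_nhdsWithin_iff.2 ⟨tendsto_nhdsWithin_of_tendsto_nhds
        (Continuous.tendsto' (by fun_prop) _ _ (by simp)),
        eventually_mem_nhdsWithin.mono fun t ht => Set.mem_Ioi.2 (half_pos ht)⟩))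
  have hunit : ∀ᶠ t in 𝓝[>] (0 : ℝ), t ∈ Set.Ioo (0 : ℝ) 1 := Ioo_mem_nhdsGT zero_lt_one
  obtain ⟨t, hle, ht, hlog_gt⟩ := (hC.and (hunit.and
    (hlog.eventually_gt_atTop (4 * C / (podeWeight (Q p) i * podeWeight (Q p) j))))).exists
  have hgain := stepEntropy_add_le_stepEntropy_mixing_half (podeWeight_nonneg (Q p)) hmem hv
    ⟨ht.1.le, ht.2.le⟩
  have hentropy := mul_le_mul_of_nonneg_left
    (neg_mul_log_le_binEntropy (u := t / 2) ⟨by linarith [ht.1], by linarith [ht.2]⟩) hw.le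
  have hlarge := mul_lt_mul_of_pos_left ((div_lt_iff₀' hw).1 hlog_gt) ht.1
  linarith

end IsOptimalStepFamily

/-! ### The Euler–Lagrange equations -/

section FirstVariation

variable {ι : Type*} [Fintype ι]

/-- The weighted sum of the block function `f`; it is the polarization, in the pode sizes, of the
edge density. -/
def blockSum (w₁ w₂ : ι → ℝ) (f : ι → ι → ℝ) : ℝ := ∑ i, ∑ j, w₁ i * w₂ j * f i j

lemma blockSum_comm {w₁ w₂ : ι → ℝ} {f : ι → ι → ℝ} (hf : ∀ i j, f i j = f j i) :
    blockSum w₁ w₂ f = blockSum w₂ w₁ f := by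
  rw [blockSum, Finset.sum_comm]
  refine Finset.sum_congr rfl fun j _ => Finset.sum_congr rfl fun i _ => ?_
  rw [hf i j, mul_comm (w₁ i)]

lemma codegree_comm {w : ι → ℝ} {v : ι → ι → ℝ} (hv : ∀ i j, v i j = v j i) (i j : ι) :
    codegree w v i j = codegree w v j i :=
  Finset.sum_congr rfl fun k _ => by rw [hv i k, hv k j, mul_comm (v k i)]

lemma hasDerivAt_blockSum {w : ℝ → ι → ℝ} {f : ℝ → ι → ι → ℝ} {w' : ι → ℝ} {f' : ι → ι → ℝ}
    {t : ℝ} (hw : ∀ i, HasDerivAt (fun s => w s i) (w' i) t)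
    (hf : ∀ i j, HasDerivAt (fun s => f s i j) (f' i j) t) (hsymm : ∀ i j, f t i j = f t j i) :
    HasDerivAt (fun s => blockSum (w s) (w s) (f s))
      (2 * blockSum w' (w t) (f t) + blockSum (w t) (w t) f') t := by
  refine (HasDerivAt.fun_sum fun i _ => HasDerivAt.fun_sum fun j _ =>
    ((hw i).mul (hw j)).mul (hf i j)).congr_deriv ?_
  simp only [add_mul, Finset.sum_add_distrib]
  change blockSum w' (w t) (f t) + blockSum (w t) w' (f t) + blockSum (w t) (w t) f' = _
  rw [blockSum_comm hsymm (w₁ := w t)]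
  ring

lemma hasDerivAt_stepEntropy {w : ℝ → ι → ℝ} {v : ℝ → ι → ι → ℝ} {w' : ι → ℝ} {v' : ι → ι → ℝ}
    {t : ℝ} (hw : ∀ i, HasDerivAt (fun s => w s i) (w' i) t)
    (hv : ∀ i j, HasDerivAt (fun s => v s i j) (v' i j) t) (hsymm : ∀ i j, v t i j = v t j i)
    (hmem : ∀ i j, v t i j ∈ Set.Ioo (0 : ℝ) 1) :
    HasDerivAt (fun s => stepEntropy (w s) (v s))
      (blockSum w' (w t) (fun i j => Real.binEntropy (v t i j)) +
        blockSum (w t) (w t) (fun i j => entropySlope (v t i j) * v' i j) / 2) t := by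
  refine ((hasDerivAt_blockSum hw (fun i j => (hasDerivAt_binEntropy (hmem i j)).comp t (hv i j))
    fun i j => by simp only [Function.comp_apply, hsymm i j]).div_const 2).congr_deriv ?_
  simp only [Function.comp_apply]
  ring

lemma sum_sum_sum_rotate (f : ι → ι → ι → ℝ) :
    ∑ i, ∑ j, ∑ k, f j k i = ∑ i, ∑ j, ∑ k, f i j k := by
  rw [Finset.sum_comm]
  exact Finset.sum_congr rfl fun _ _ => Finset.sum_comm

lemma sum_sum_sum_eq_blockSum_codegree {w w' : ι → ℝ} {v f : ι → ι → ℝ}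
    (hv : ∀ i j, v i j = v j i) :
    ∑ i, ∑ j, ∑ k, w' i * w j * w k * (f i j * v j k * v k i) =
      blockSum w' w fun i j => f i j * codegree w v i j := by
  refine Finset.sum_congr rfl fun i _ => Finset.sum_congr rfl fun j _ => ?_
  simp only [codegree, Finset.mul_sum]
  refine Finset.sum_congr rfl fun k _ => ?_
  rw [hv k i, hv j k]
  ring

lemma hasDerivAt_stepTriangle {w : ℝ → ι → ℝ} {v : ℝ → ι → ι → ℝ} {w' : ι → ℝ} {v' : ι → ι → ℝ}
    {t : ℝ} (hw : ∀ i, HasDerivAt (fun s => w s i) (w' i) t)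
    (hv : ∀ i j, HasDerivAt (fun s => v s i j) (v' i j) t) (hsymm : ∀ i j, v t i j = v t j i) :
    HasDerivAt (fun s => stepTriangle (w s) (v s))
      (3 * (blockSum w' (w t) (fun i j => v t i j * codegree (w t) (v t) i j) +
        blockSum (w t) (w t) (fun i j => v' i j * codegree (w t) (v t) i j))) t := by
  let term (i j k : ι) : ℝ := w' i * w t j * w t k * (v t i j * v t j k * v t k i) +
    w t i * w t j * w t k * (v' i j * v t j k * v t k i)
  have hderiv := HasDerivAt.fun_sum fun i (_ : i ∈ Finset.univ) =>
    HasDerivAt.fun_sum fun j (_ : j ∈ Finset.univ) =>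
    HasDerivAt.fun_sum fun k (_ : k ∈ Finset.univ) =>
      (((hw i).mul (hw j)).mul (hw k)).mul (((hv i j).mul (hv j k)).mul (hv k i))
  refine hderiv.congr_deriv ?_
  calc _ = ∑ i, ∑ j, ∑ k, (term i j k + term j k i + term k i j) :=
        Finset.sum_congr rfl fun i _ => Finset.sum_congr rfl fun j _ =>
          Finset.sum_congr rfl fun k _ => by simp only [term, Pi.mul_apply]; ring
    _ = 3 * ∑ i, ∑ j, ∑ k, term i j k := by
        simp only [Finset.sum_add_distrib]
        rw [sum_sum_sum_rotate fun i j k => term j k i, sum_sum_sum_rotate term]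
        ring
    _ = _ := by
        simp only [term, Finset.sum_add_distrib, sum_sum_sum_eq_blockSum_codegree hsymm]

/-- The Euler–Lagrange equations, with multipliers `α` for the edge density and `β` for the
triangle density, of a step graphon with pode sizes `w` and values `v` in `(0,1)`, when the pode
sizes may be varied in the direction `w'`. -/
structure IsCriticalStep (w w' : ι → ℝ) (v : ι → ι → ℝ) (α β : ℝ) : Prop where
  mem_Ioo : ∀ i j, v i j ∈ Set.Ioo (0 : ℝ) 1
  nonneg : 0 ≤ β
  slope : ∀ i j, entropySlope (v i j) = 2 * α + 6 * β * codegree w v i j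
  size : blockSum w' w (fun i j => Real.binEntropy (v i j)) =
    2 * α * blockSum w' w v + 3 * β * blockSum w' w fun i j => v i j * codegree w v i j

end FirstVariation

lemma nonneg_of_hasDerivAt_of_eventually_le {f : ℝ → ℝ} {f' : ℝ} (hf : HasDerivAt f f' 0)
    (hle : ∀ᶠ t in 𝓝[>] (0 : ℝ), f 0 ≤ f t) : 0 ≤ f' := by
  have hslope : Tendsto (slope f 0) (𝓝[>] 0) (𝓝 f') :=
    (hasDerivAt_iff_tendsto_slope.1 hf).mono_left (nhdsWithin_mono _ fun _ hx => ne_of_gt hx)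
  refine ge_of_tendsto hslope ?_
  filter_upwards [hle, self_mem_nhdsWithin] with t ht ht₀
  rw [slope_def_field]
  exact div_nonneg (sub_nonneg.2 ht) (sub_nonneg.2 (le_of_lt ht₀))

lemma hasDerivAt_eq_of_eventually_le {E : Type*} [NormedAddCommGroup E] [NormedSpace ℝ E]
    {M : E → ℝ} {M' : E →L[ℝ] ℝ} {γ : ℝ → E} {γ' : E} {s : ℝ → ℝ} {s' : ℝ}
    (hM : HasFDerivAt M M' (γ 0)) (hγ : HasDerivAt γ γ' 0) (hs : HasDerivAt s s' 0)
    (hle : ∀ᶠ t in 𝓝 0, s t ≤ M (γ t)) (heq : s 0 = M (γ 0)) : s' = M' γ' := by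
  have hmax : IsLocalMax (fun t => s t - M (γ t)) 0 := by
    filter_upwards [hle] with t ht
    rw [heq, sub_self]
    exact sub_nonpos.2 ht
  exact sub_eq_zero.1 (hmax.hasDerivAt_eq_zero (hs.sub (hM.comp_hasDerivAt 0 hγ)))

namespace IsOptimalStepFamily

variable {ι : Type*} [Fintype ι] [MeasurableSpace ι] [MeasurableSingletonClass ι]
  {Q : ℝ × ℝ → I → ι} {v : ℝ × ℝ → ι → ι → ℝ} {p : ℝ × ℝ}

lemma differentiableAt_stepEntropy (hF : IsOptimalStepFamily Q v p) :
    DifferentiableAt ℝ (fun q => stepEntropy (podeWeight (Q q)) (v q)) p := by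
  have hentropy i j : DifferentiableAt ℝ (fun q => Real.binEntropy (v q i j)) p :=
    DifferentiableAt.comp (g := Real.binEntropy) p
      (hasDerivAt_binEntropy (hF.value_mem_Ioo i j)).differentiableAt
      (hF.analyticAt_value i j).differentiableAt
  have hweight := hF.differentiableAt_weight
  simp only [stepEntropy]
  fun_prop

/- The envelope theorem: the multipliers are the partial derivatives of the maximal entropy. -/
lemma first_variation (hF : IsOptimalStepFamily Q v p) {α β : ℝ} {M' : ℝ × ℝ →L[ℝ] ℝ}
    (hM : HasFDerivAt (fun q => stepEntropy (podeWeight (Q q)) (v q)) M' p)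
    (hα : M' (1, 0) = α) (hβ : M' (0, 1) = β)
    {R : ℝ → I → ι} {u : ℝ → ι → ι → ℝ} {w' : ι → ℝ} {u' : ι → ι → ℝ}
    (hR : ∀ t, Measurable (R t)) (hR₀ : R 0 = Q p) (hu₀ : u 0 = v p)
    (hw : ∀ i, HasDerivAt (fun t => podeWeight (R t) i) (w' i) 0)
    (hu : ∀ i j, HasDerivAt (fun t => u t i j) (u' i j) 0) (hsymm : ∀ t i j, u t i j = u t j i) :
    blockSum w' (podeWeight (Q p)) (fun i j => Real.binEntropy (v p i j)) +
        blockSum (podeWeight (Q p)) (podeWeight (Q p))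
          (fun i j => entropySlope (v p i j) * u' i j) / 2 =
      (2 * blockSum w' (podeWeight (Q p)) (v p) +
          blockSum (podeWeight (Q p)) (podeWeight (Q p)) u') * α +
        3 * (blockSum w' (podeWeight (Q p))
            (fun i j => v p i j * codegree (podeWeight (Q p)) (v p) i j) +
          blockSum (podeWeight (Q p)) (podeWeight (Q p))
            (fun i j => u' i j * codegree (podeWeight (Q p)) (v p) i j)) * β := by
  have hmem : ∀ᶠ t in 𝓝 0, ∀ i j, u t i j ∈ Set.Icc (0 : ℝ) 1 :=
    eventually_all.2 fun i => eventually_all.2 fun j =>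
      ((hu i j).continuousAt.eventually (isOpen_Ioo.mem_nhds
        (by simpa only [hu₀] using hF.value_mem_Ioo i j))).mono fun t ht =>
          Set.Ioo_subset_Icc_self ht
  let γ : ℝ → ℝ × ℝ := fun t =>
    (stepEdge (podeWeight (R t)) (u t), stepTriangle (podeWeight (R t)) (u t))
  have hγ₀ : γ 0 = p := by simpa only [γ, hR₀, hu₀] using hF.densities_eq
  have hγ := (hasDerivAt_blockSum hw hu (hsymm 0)).prodMk (hasDerivAt_stepTriangle hw hu (hsymm 0))
  have hle : ∀ᶠ t in 𝓝 0, stepEntropy (podeWeight (R t)) (u t) ≤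
      stepEntropy (podeWeight (Q (γ t))) (v (γ t)) := by
    filter_upwards [(hγ₀ ▸ hγ.continuousAt.tendsto : Tendsto γ (𝓝 0) (𝓝 p)).eventually
      hF.eventually_entropy_le, hmem] with t hmax ht
    rw [← entropy_step (hR t)]
    exact hmax _ (isGraphon_step (hR t) (hsymm t) ht) (edgeDensity_step (hR t) _)
      (triangleDensity_step (hR t) _)
  have hentropy := hasDerivAt_stepEntropy hw hu (hsymm 0)
    (by simpa only [hu₀] using hF.value_mem_Ioo)
  have hcritical := hasDerivAt_eq_of_eventually_le (γ := γ) (hγ₀.symm ▸ hM) hγ hentropy hle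
    (by rw [hγ₀, hR₀, hu₀])
  have hsplit (x y : ℝ) : M' (x, y) = x * α + y * β := by
    rw [← hα, ← hβ, ← smul_eq_mul, ← smul_eq_mul, ← map_smul, ← map_smul, ← map_add]
    simp
  rw [hsplit, hR₀, hu₀] at hcritical
  exact hcritical

lemma entropySlope_eq (hF : IsOptimalStepFamily Q v p) {α β : ℝ} {M' : ℝ × ℝ →L[ℝ] ℝ}
    (hM : HasFDerivAt (fun q => stepEntropy (podeWeight (Q q)) (v q)) M' p)
    (hα : M' (1, 0) = α) (hβ : M' (0, 1) = β) (i j : ι) :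
    entropySlope (v p i j) = 2 * α + 6 * β * codegree (podeWeight (Q p)) (v p) i j := by
  set w := podeWeight (Q p)
  let δ : ι → ι → ℝ := fun i j => entropySlope (v p i j) - (2 * α + 6 * β * codegree w (v p) i j)
  have hδ i j : δ i j = δ j i := by simp only [δ, hF.symm p i j, codegree_comm (hF.symm p) i j]
  have hvariation := hF.first_variation hM hα hβ (R := fun _ => Q p)
    (u := fun t i j => v p i j + t * δ i j) (w' := 0) (u' := δ) (fun _ => hF.measurable p) rfl
    (by simp) (fun _ => hasDerivAt_const _ _)
    (fun i j => by simpa using ((hasDerivAt_id (0 : ℝ)).mul_const (δ i j)).const_add (v p i j))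
    (fun t i j => by rw [hF.symm p i j, hδ i j])
  have hsum : ∑ i, ∑ j, w i * w j * δ i j ^ 2 = 0 := by
    calc ∑ i, ∑ j, w i * w j * δ i j ^ 2 = ∑ i, ∑ j, (w i * w j * (entropySlope (v p i j) * δ i j) -
          2 * α * (w i * w j * δ i j) - 6 * β * (w i * w j * (δ i j * codegree w (v p) i j))) :=
          Finset.sum_congr rfl fun i _ => Finset.sum_congr rfl fun j _ => by
            simp only [δ]; ring
      _ = 0 := by
          simp only [blockSum, Pi.zero_apply, zero_mul, Finset.sum_const_zero] at hvariation
          simp only [Finset.sum_sub_distrib, ← Finset.mul_sum]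
          linarith
  have hterm i j : 0 ≤ w i * w j * δ i j ^ 2 :=
    mul_nonneg (mul_pos (hF.weight_pos i) (hF.weight_pos j)).le (sq_nonneg _)
  have hzero := (Finset.sum_eq_zero_iff_of_nonneg fun j _ => hterm i j).1
    ((Finset.sum_eq_zero_iff_of_nonneg fun i _ => Finset.sum_nonneg fun j _ => hterm i j).1 hsum i
      (Finset.mem_univ i)) j (Finset.mem_univ j)
  exact sub_eq_zero.1 (pow_eq_zero_iff two_ne_zero |>.1
    ((mul_eq_zero_iff_left (mul_pos (hF.weight_pos i) (hF.weight_pos j)).ne').1 hzero))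

/- Raising the triangle density only relaxes the constraint. -/
lemma fderiv_nonneg (hF : IsOptimalStepFamily Q v p) (hp : ∀ᶠ q in 𝓝 p, q.2 ≤ q.1 ^ 3)
    {M' : ℝ × ℝ →L[ℝ] ℝ}
    (hM : HasFDerivAt (fun q => stepEntropy (podeWeight (Q q)) (v q)) M' p) :
    0 ≤ M' (0, 1) := by
  let γ : ℝ → ℝ × ℝ := fun t => p + t • (0, 1)
  have hγ₀ : γ 0 = p := by simp [γ]
  have hγ : HasDerivAt γ (0, 1) 0 :=
    (((hasDerivAt_id (0 : ℝ)).smul_const ((0, 1) : ℝ × ℝ)).const_add p).congr_deriv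
      (one_smul _ _)
  have hγ_tendsto : Tendsto γ (𝓝[>] 0) (𝓝 p) :=
    hγ₀ ▸ hγ.continuousAt.tendsto.mono_left nhdsWithin_le_nhds
  refine nonneg_of_hasDerivAt_of_eventually_le ((hγ₀.symm ▸ hM).comp_hasDerivAt 0 hγ) ?_
  filter_upwards [hγ_tendsto.eventually hF.isOptimizer, hγ_tendsto.eventually hp,
    self_mem_nhdsWithin] with t hopt hbelow ht
  have hle := hopt.stepEntropy_le_entropy hbelow (hF.measurable p) (hF.symm p)
    hF.mem_Icc.self_of_nhds
    ((congrArg Prod.fst hF.densities_eq).trans (by simp [γ]))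
    ((congrArg Prod.snd hF.densities_eq).trans_le (by simpa [γ] using (Set.mem_Ioi.1 ht).le))
  rw [entropy_step (hF.measurable _)] at hle
  simpa only [Function.comp_apply, hγ₀] using hle

lemma exists_isCriticalStep (hF : IsOptimalStepFamily Q v p) (hp : ∀ᶠ q in 𝓝 p, q.2 ≤ q.1 ^ 3)
    {R : ℝ → I → ι} {w' : ι → ℝ} (hR : ∀ t, Measurable (R t)) (hR₀ : R 0 = Q p)
    (hw : ∀ i, HasDerivAt (fun t => podeWeight (R t) i) (w' i) 0) :
    ∃ α β, IsCriticalStep (podeWeight (Q p)) w' (v p) α β := by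
  have hM := hF.differentiableAt_stepEntropy.hasFDerivAt
  refine ⟨_, _, hF.value_mem_Ioo, hF.fderiv_nonneg hp hM, hF.entropySlope_eq hM rfl rfl, ?_⟩
  have hvariation := hF.first_variation hM rfl rfl (u := fun _ => v p) (u' := 0) hR hR₀ rfl hw
    (fun _ _ => hasDerivAt_const _ _) fun _ => hF.symm p
  simp only [blockSum, Pi.zero_apply, zero_mul, mul_zero, Finset.sum_const_zero, zero_div,
    add_zero] at hvariation
  simp only [blockSum]
  linarith

end IsOptimalStepFamily

/-! ### Bipodal and tripodal graphons -/

/-- The labelling of the podes of a tripodal graphon. -/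
def podeIndex (c : ℝ) (x : I) : Fin 3 := if (x : ℝ) < c then if (x : ℝ) < c / 2 then 0 else 1 else 2

/-- The pode sizes of a tripodal graphon. -/
def podeSize (c : ℝ) : Fin 3 → ℝ := ![c / 2, c / 2, 1 - c]

/-- The matrix of values of a tripodal graphon. -/
def podeValue (ap am b d : ℝ) : Fin 3 → Fin 3 → ℝ := ![![am, ap, d], ![ap, am, d], ![d, d, b]]

/-- The labelling of the podes of a bipodal graphon. -/
def bipodeIndex (c : ℝ) (x : I) : Fin 2 := if (x : ℝ) < c then 0 else 1

/-- The pode sizes of a bipodal graphon. -/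
def bipodeSize (c : ℝ) : Fin 2 → ℝ := ![c, 1 - c]

/-- The matrix of values of a bipodal graphon. -/
def bipodeValue (a b d : ℝ) : Fin 2 → Fin 2 → ℝ := ![![a, d], ![d, b]]

lemma tripodal_eq_step (ap am b c d : ℝ) :
    tripodal ap am b c d = step (podeIndex c) (podeValue ap am b d) := by
  funext x y
  unfold tripodal step podeValue podeIndex
  split_ifs <;> simp_all

lemma bipodal_eq_step (a b c d : ℝ) :
    bipodal a b c d = step (bipodeIndex c) (bipodeValue a b d) := by
  funext x y
  unfold bipodal step bipodeValue bipodeIndex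
  split_ifs <;> simp_all

lemma measurable_podeIndex (c : ℝ) : Measurable (podeIndex c) :=
  (measurable_const.ite (measurableSet_lt measurable_subtype_coe measurable_const)
    measurable_const).ite (measurableSet_lt measurable_subtype_coe measurable_const)
    measurable_const

lemma measurable_bipodeIndex (c : ℝ) : Measurable (bipodeIndex c) :=
  Measurable.ite (measurableSet_lt measurable_subtype_coe measurable_const)
    measurable_const measurable_const

lemma podeWeight_podeIndex {c : ℝ} (hc : c ∈ Set.Icc (0 : ℝ) 1) :
    podeWeight (podeIndex c) = podeSize c := by
  obtain ⟨hc₀, hc₁⟩ := hc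
  let u : I := ⟨c / 2, by linarith, by linarith⟩
  let v : I := ⟨c, hc₀, hc₁⟩
  have hfirst : podeIndex c ⁻¹' {0} = Set.Iio u := by
    ext x
    simp only [podeIndex, Set.mem_preimage, Set.mem_singleton_iff, Set.mem_Iio,
      ← Subtype.coe_lt_coe, u]
    split_ifs <;> simp <;> linarith
  have hsecond : podeIndex c ⁻¹' {1} = Set.Ico u v := by
    ext x
    simp only [podeIndex, Set.mem_preimage, Set.mem_singleton_iff, Set.mem_Ico,
      ← Subtype.coe_lt_coe, ← Subtype.coe_le_coe, u, v]
    split_ifs <;> simp_all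
  have hthird : podeIndex c ⁻¹' {2} = Set.Ici v := by
    ext x
    simp only [podeIndex, Set.mem_preimage, Set.mem_singleton_iff, Set.mem_Ici,
      ← Subtype.coe_le_coe, v]
    split_ifs <;> simp <;> linarith
  funext i
  fin_cases i
  · simp [podeWeight, podeSize, hfirst, measureReal_def, u, div_nonneg hc₀]
  · have hhalf : c - c / 2 = c / 2 := by ring
    simp [podeWeight, podeSize, hsecond, measureReal_def, u, v, hhalf,
      div_nonneg hc₀]
  · simp [podeWeight, podeSize, hthird, measureReal_def, v, hc₁]

lemma podeWeight_bipodeIndex {c : ℝ} (hc : c ∈ Set.Icc (0 : ℝ) 1) :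
    podeWeight (bipodeIndex c) = bipodeSize c := by
  obtain ⟨hc₀, hc₁⟩ := hc
  let v : I := ⟨c, hc₀, hc₁⟩
  have hfirst : bipodeIndex c ⁻¹' {0} = Set.Iio v := by
    ext x
    simp only [bipodeIndex, Set.mem_preimage, Set.mem_singleton_iff, Set.mem_Iio,
      ← Subtype.coe_lt_coe, v]
    split_ifs <;> simp_all
  have hsecond : bipodeIndex c ⁻¹' {1} = Set.Ici v := by
    ext x
    simp only [bipodeIndex, Set.mem_preimage, Set.mem_singleton_iff, Set.mem_Ici,
      ← Subtype.coe_le_coe, v]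
    split_ifs <;> simp_all
  funext i
  fin_cases i
  · simp [podeWeight, bipodeSize, hfirst, measureReal_def, v, hc₀]
  · simp [podeWeight, bipodeSize, hsecond, measureReal_def, v, hc₁]

lemma podeSize_pos {c : ℝ} (hc : c ∈ Set.Ioo (0 : ℝ) 1) (i : Fin 3) : 0 < podeSize c i := by
  fin_cases i <;> simp [podeSize, hc.1, hc.2]

lemma podeValue_symm (ap am b d : ℝ) (i j : Fin 3) :
    podeValue ap am b d i j = podeValue ap am b d j i := by
  fin_cases i <;> fin_cases j <;> rfl

lemma podeValue_mem {ap am b d : ℝ} {s : Set ℝ} (hap : ap ∈ s) (ham : am ∈ s) (hb : b ∈ s)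
    (hd : d ∈ s) (i j : Fin 3) : podeValue ap am b d i j ∈ s := by
  fin_cases i <;> fin_cases j <;> assumption

lemma bipodeValue_mem {a b d : ℝ} {s : Set ℝ} (ha : a ∈ s) (hb : b ∈ s) (hd : d ∈ s)
    (i j : Fin 2) : bipodeValue a b d i j ∈ s := by
  fin_cases i <;> fin_cases j <;> assumption

/-- The edge density of `tripodal ap am b c d`. -/
def triEdge (ap am b c d : ℝ) : ℝ := stepEdge (podeSize c) (podeValue ap am b d)

/-- The triangle density of `tripodal ap am b c d`. -/
def triTriangle (ap am b c d : ℝ) : ℝ := stepTriangle (podeSize c) (podeValue ap am b d)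

/-- The entropy of `tripodal ap am b c d`. -/
def triEntropy (ap am b c d : ℝ) : ℝ := stepEntropy (podeSize c) (podeValue ap am b d)

lemma triEdge_eq (ap am b c d : ℝ) :
    triEdge ap am b c d = c ^ 2 / 2 * (ap + am) + 2 * c * (1 - c) * d + (1 - c) ^ 2 * b := by
  simp only [triEdge, stepEdge, podeSize, podeValue, Fin.sum_univ_three, Matrix.cons_val]
  ring

lemma triTriangle_eq (ap am b c d : ℝ) :
    triTriangle ap am b c d = c ^ 3 / 8 * ((am + ap) ^ 3 + (am - ap) ^ 3) +
      3 / 2 * (1 - c) * c ^ 2 * d ^ 2 * (am + ap) + 3 * (1 - c) ^ 2 * c * b * d ^ 2 +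
      (1 - c) ^ 3 * b ^ 3 := by
  simp only [triTriangle, stepTriangle, podeSize, podeValue, Fin.sum_univ_three, Matrix.cons_val]
  ring

lemma triEntropy_eq (ap am b c d : ℝ) :
    triEntropy ap am b c d = c ^ 2 / 4 * (Real.binEntropy ap + Real.binEntropy am) +
      c * (1 - c) * Real.binEntropy d + (1 - c) ^ 2 / 2 * Real.binEntropy b := by
  simp only [triEntropy, stepEntropy, podeSize, podeValue, Fin.sum_univ_three, Matrix.cons_val]
  ring

/-- No tripodal graphon with the same edge density and at most as many triangles has more
entropy. -/
def IsMaximalTripodal (ap am b c d : ℝ) : Prop :=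
  ∀ ap' am' b' c' d' : ℝ, ap' ∈ Set.Icc (0 : ℝ) 1 → am' ∈ Set.Icc (0 : ℝ) 1 →
    b' ∈ Set.Icc (0 : ℝ) 1 → c' ∈ Set.Icc (0 : ℝ) 1 → d' ∈ Set.Icc (0 : ℝ) 1 →
    triEdge ap' am' b' c' d' = triEdge ap am b c d →
    triTriangle ap' am' b' c' d' ≤ triTriangle ap am b c d →
    triEntropy ap' am' b' c' d' ≤ triEntropy ap am b c d

lemma IsOptimizer.isMaximalTripodal {p : ℝ × ℝ} {ap am b c d : ℝ} (hp : p.2 ≤ p.1 ^ 3)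
    (hc : c ∈ Set.Icc (0 : ℝ) 1) (hopt : IsOptimizer p (tripodal ap am b c d)) :
    IsMaximalTripodal ap am b c d := by
  intro ap' am' b' c' d' hap ham hb hc' hd hedge htriangle
  have hq := measurable_podeIndex c
  rw [tripodal_eq_step] at hopt
  have hedge_eq := hopt.edge
  have htriangle_eq := hopt.triangle
  rw [edgeDensity_step hq, podeWeight_podeIndex hc] at hedge_eq
  rw [triangleDensity_step hq, podeWeight_podeIndex hc] at htriangle_eq
  have hle := hopt.stepEntropy_le_entropy hp (measurable_podeIndex c')
    (podeValue_symm ap' am' b' d') (podeValue_mem hap ham hb hd)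
    (by rw [podeWeight_podeIndex hc']; exact hedge.trans hedge_eq)
    (by rw [podeWeight_podeIndex hc']; exact htriangle.trans_eq htriangle_eq)
  rwa [entropy_step hq, podeWeight_podeIndex hc, podeWeight_podeIndex hc'] at hle

lemma hasDerivAt_podeWeight_podeIndex {c : ℝ} (hc : c ∈ Set.Ioo (0 : ℝ) 1) (i : Fin 3) :
    HasDerivAt (fun t => podeWeight (podeIndex t) i) ((![1 / 2, 1 / 2, -1] : Fin 3 → ℝ) i) c := by
  have hsize : HasDerivAt (fun t => podeSize t i) ((![1 / 2, 1 / 2, -1] : Fin 3 → ℝ) i) c := by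
    fin_cases i
    exacts [(hasDerivAt_id c).div_const 2, (hasDerivAt_id c).div_const 2,
      (hasDerivAt_id c).const_sub 1]
  refine hsize.congr_of_eventuallyEq ?_
  filter_upwards [isOpen_Ioo.mem_nhds hc] with t ht
  rw [podeWeight_podeIndex (Set.Ioo_subset_Icc_self ht)]

lemma IsB21orC12Phase.exists_isCriticalStep {V : Set (ℝ × ℝ)} (hV : IsB21orC12Phase V)
    {p : ℝ × ℝ} (hp : p ∈ V) :
    ∃ ap am b c d α β, IsB21orC12 ap am b c d ∧ IsUniqueOptimizer p (tripodal ap am b c d) ∧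
      IsCriticalStep (podeSize c) ![1 / 2, 1 / 2, -1] (podeValue ap am b d) α β := by
  obtain ⟨ap, am, b, c, d, hap, ham, hb, hc, hd, hopt⟩ := hV.optimal p hp
  obtain ⟨htype, hunique⟩ := hopt.self_of_nhds
  have hweight := podeWeight_podeIndex (Set.Ioo_subset_Icc_self htype.c_mem)
  have hF : IsOptimalStepFamily (fun q => podeIndex (c q))
      (fun q => podeValue (ap q) (am q) (b q) (d q)) p :=
    { measurable := fun q => measurable_podeIndex (c q)
      symm := fun q => podeValue_symm _ _ _ _
      mem_Icc := hopt.mono fun q hq => podeValue_mem hq.1.ap_mem hq.1.am_mem hq.1.b_mem hq.1.d_mem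
      weight_pos := fun i => hweight ▸ podeSize_pos htype.c_mem i
      analyticAt_value := fun i j => by fin_cases i <;> fin_cases j <;> assumption
      differentiableAt_weight := fun i => DifferentiableAt.comp (g := fun t =>
        podeWeight (podeIndex t) i) p
        (hasDerivAt_podeWeight_podeIndex htype.c_mem i).differentiableAt hc.differentiableAt
      isOptimizer := hopt.mono fun q hq => tripodal_eq_step _ _ _ _ _ ▸ hq.2.1 }
  obtain ⟨α, β, hcritical⟩ := hF.exists_isCriticalStep
    (mem_of_superset (hV.isOpen.mem_nhds hp) fun q hq => (hV.below q hq).le)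
    (R := fun t => podeIndex (c p + t)) (w' := ![1 / 2, 1 / 2, -1])
    (fun t => measurable_podeIndex _) (by simp)
    fun i => HasDerivAt.comp_const_add (c p) 0
      ((add_zero (c p)).symm ▸ hasDerivAt_podeWeight_podeIndex htype.c_mem i)
  exact ⟨_, _, _, _, _, α, β, htype, hunique, hweight ▸ hcritical⟩

/-! ### Cut distance between step graphons -/

lemma abs_setIntegral_sub_le_labelledCutDist {f g : I → I → ℝ}
    (hf : ∀ x y, f x y ∈ Set.Icc (0 : ℝ) 1) (hg : ∀ x y, g x y ∈ Set.Icc (0 : ℝ) 1)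
    {S T : Set I} (hS : MeasurableSet S) (hT : MeasurableSet T) :
    |∫ x in S, ∫ y in T, (f x y - g x y)| ≤ labelledCutDist f g := by
  have hbound x y : ‖f x y - g x y‖ ≤ 1 := by
    rw [Real.norm_eq_abs]
    exact abs_sub_le_of_nonneg_of_le (hf x y).1 (hf x y).2 (hg x y).1 (hg x y).2
  have hset (A : Set I) {k : I → ℝ} (hk : ∀ x, ‖k x‖ ≤ 1) : ‖∫ x in A, k x‖ ≤ 1 :=
    (norm_setIntegral_le_of_norm_le_const (measure_lt_top _ _) fun x _ => hk x).trans
      (by simp)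
  refine le_csSup ⟨1, ?_⟩ ⟨S, T, hS, hT, rfl⟩
  rintro r ⟨S, T, -, -, rfl⟩
  exact hset S fun x => hset T (hbound x)

lemma exists_labelledCutDist_lt_of_cutDist_lt {f g : I → I → ℝ} {r : ℝ} (h : cutDist f g < r) :
    ∃ φ : I ≃ᵐ I, MeasurePreserving φ volume volume ∧
      labelledCutDist f (fun x y => g (φ x) (φ y)) < r := by
  have : Nonempty {φ : I ≃ᵐ I // MeasurePreserving φ volume volume} :=
    ⟨⟨MeasurableEquiv.refl I, MeasurePreserving.id _⟩⟩
  obtain ⟨φ, hφ⟩ := exists_lt_of_ciInf_lt h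
  exact ⟨φ.1, φ.2, hφ⟩

lemma IsGraphon.setIntegral_sub_const {g : I → I → ℝ} (hg : IsGraphon g) (S T : Set I) (C : ℝ) :
    ∫ x in S, ∫ y in T, (g x y - C) =
      (∫ x in S, ∫ y in T, g x y) - C * volume.real S * volume.real T := by
  have hbound x y : ‖g x y‖ ≤ 1 := by
    rw [Real.norm_eq_abs, abs_of_nonneg (hg.mem_Icc x y).1]
    exact (hg.mem_Icc x y).2
  have hinner x : ∫ y in T, (g x y - C) = (∫ y in T, g x y) - C * volume.real T := by
    have hmeas : Measurable (g x) := hg.measurable.comp measurable_prodMk_left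
    rw [integral_sub (Integrable.of_bound hmeas.aestronglyMeasurable 1 (ae_of_all _ (hbound x)))
      (integrable_const C)]
    simp [mul_comm]
  have hintegrable : Integrable (fun x => ∫ y in T, g x y) (volume.restrict S) :=
    Integrable.of_bound
      (hg.measurable.stronglyMeasurable.integral_prod_right).aestronglyMeasurable 1
      (ae_of_all _ fun x => (norm_setIntegral_le_of_norm_le_const (measure_lt_top _ _)
        fun y _ => hbound x y).trans (by simp))
  simp only [hinner]
  rw [integral_sub hintegrable (integrable_const _)]
  simp only [integral_const, MeasurableSet.univ, measureReal_restrict_apply, Set.univ_inter,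
    smul_eq_mul]
  ring

lemma podeWeight_comp {ι : Type*} [MeasurableSpace ι] [MeasurableSingletonClass ι]
    {q : I → ι} (hq : Measurable q) {φ : I → I}
    (hφ : MeasurePreserving φ volume volume) : podeWeight (q ∘ φ) = podeWeight q :=
  funext fun i => hφ.measureReal_preimage (hq (MeasurableSet.singleton i)).nullMeasurableSet

lemma abs_setIntegral_sub_le_of_step {g : I → I → ℝ} (hg : IsGraphon g) {ι : Type*}
    {F : I → ι} {v : ι → ι → ℝ} (hv : ∀ i k, v i k ∈ Set.Icc (0 : ℝ) 1) {S T : Set I}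
    (hS : MeasurableSet S) (hT : MeasurableSet T) {i k : ι} (hSi : ∀ x ∈ S, F x = i)
    (hTk : ∀ y ∈ T, F y = k) :
    |(∫ x in S, ∫ y in T, g x y) - v i k * volume.real S * volume.real T| ≤
      labelledCutDist g (step F v) := by
  have hstep : ∫ x in S, ∫ y in T, (g x y - step F v x y) = ∫ x in S, ∫ y in T, (g x y - v i k) :=
    setIntegral_congr_fun hS fun x hx => setIntegral_congr_fun hT fun y hy => by
      simp only [step, hSi x hx, hTk y hy]
  rw [← hg.setIntegral_sub_const, ← hstep]
  exact abs_setIntegral_sub_le_labelledCutDist hg.mem_Icc (fun x y => hv _ _) hS hT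

section Coupling

variable {ι κ : Type*} [Fintype ι] [Fintype κ]

/-- `x` is a coupling of the pode sizes `w` and `w₀`: `x i j` is the size of the part shared by
the `i`-th pode of one partition and the `j`-th pode of another one. -/
structure IsCoupling (x : ι → κ → ℝ) (w : ι → ℝ) (w₀ : κ → ℝ) : Prop where
  nonneg : ∀ i j, 0 ≤ x i j
  row_sum : ∀ i, ∑ j, x i j = w i
  col_sum : ∀ j, ∑ i, x i j = w₀ j

lemma isClosed_isCoupling :
    IsClosed {z : (ι → κ → ℝ) × (ι → ℝ) × (κ → ℝ) | IsCoupling z.1 z.2.1 z.2.2} := by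
  have hset : {z : (ι → κ → ℝ) × (ι → ℝ) × (κ → ℝ) | IsCoupling z.1 z.2.1 z.2.2} =
      {z | (∀ i j, 0 ≤ z.1 i j) ∧ (∀ i, ∑ j, z.1 i j = z.2.1 i) ∧ ∀ j, ∑ i, z.1 i j = z.2.2 j} :=
    Set.ext fun z => ⟨fun h => ⟨h.1, h.2, h.3⟩, fun h => ⟨h.1, h.2.1, h.2.2⟩⟩
  rw [hset]
  simp only [Set.ofPred_and, Set.ofPred_forall]
  refine (isClosed_iInter fun i => isClosed_iInter fun j => isClosed_le ?_ ?_).inter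
    ((isClosed_iInter fun i => isClosed_eq ?_ ?_).inter
      (isClosed_iInter fun j => isClosed_eq ?_ ?_)) <;> fun_prop

lemma IsCoupling.le_col {x : ι → κ → ℝ} {w : ι → ℝ} {w₀ : κ → ℝ} (hx : IsCoupling x w w₀)
    (i : ι) (j : κ) : x i j ≤ w₀ j :=
  (Finset.single_le_sum (fun i _ => hx.nonneg i j) (Finset.mem_univ i)).trans_eq (hx.col_sum j)

lemma exists_subseq_tendsto_isCoupling {w : ℕ → ι → ℝ} {v : ℕ → ι → ι → ℝ} {w₀ : κ → ℝ}
    {v₀ : κ → κ → ℝ} {x : ℕ → ι → κ → ℝ} {r : ℕ → ℝ} (hr : Tendsto r atTop (𝓝 0))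
    (hw : ∀ n i, w n i ∈ Set.Icc (0 : ℝ) 1) (hv : ∀ n i k, v n i k ∈ Set.Icc (0 : ℝ) 1)
    (hx : ∀ n, IsCoupling (x n) (w n) w₀)
    (hclose : ∀ n i j k l, |v n i k - v₀ j l| * (x n i j * x n k l) ≤ r n) :
    ∃ (φ : ℕ → ℕ) (w₁ : ι → ℝ) (v₁ : ι → ι → ℝ) (x₁ : ι → κ → ℝ), StrictMono φ ∧
      Tendsto (w ∘ φ) atTop (𝓝 w₁) ∧ Tendsto (v ∘ φ) atTop (𝓝 v₁) ∧ IsCoupling x₁ w₁ w₀ ∧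
      ∀ i j k l, x₁ i j ≠ 0 → x₁ k l ≠ 0 → v₁ i k = v₀ j l := by
  have hmem n : (x n, w n, v n) ∈
      Set.Icc (0 : (ι → κ → ℝ) × (ι → ℝ) × (ι → ι → ℝ)) (fun _ => w₀, 1, 1) :=
    ⟨⟨(hx n).nonneg, fun i => (hw n i).1, fun i k => (hv n i k).1⟩,
      (hx n).le_col, fun i => (hw n i).2, fun i k => (hv n i k).2⟩
  obtain ⟨⟨x₁, w₁, v₁⟩, -, φ, hφ, hlim⟩ := isCompact_Icc.tendsto_subseq hmem
  obtain ⟨hx₁, hwv⟩ := Prod.tendsto_iff _ _ |>.1 hlim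
  obtain ⟨hw₁, hv₁⟩ := Prod.tendsto_iff _ _ |>.1 hwv
  refine ⟨φ, w₁, v₁, x₁, hφ, hw₁, hv₁, isClosed_isCoupling.mem_of_tendsto
    (hx₁.prodMk_nhds (hw₁.prodMk_nhds tendsto_const_nhds)) (Eventually.of_forall fun n => hx (φ n)),
    fun i j k l hij hkl => ?_⟩
  have hentry i j : Tendsto (fun n => x (φ n) i j) atTop (𝓝 (x₁ i j)) :=
    tendsto_pi_nhds.1 (tendsto_pi_nhds.1 hx₁ i) j
  have hvalue : Tendsto (fun n => v (φ n) i k) atTop (𝓝 (v₁ i k)) :=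
    tendsto_pi_nhds.1 (tendsto_pi_nhds.1 hv₁ i) k
  have hlimit := le_of_tendsto_of_tendsto'
    ((hvalue.sub_const (v₀ j l)).abs.mul ((hentry i j).mul (hentry k l)))
    (hr.comp hφ.tendsto_atTop) fun n => hclose (φ n) i j k l
  have hpos {i j} (hij : x₁ i j ≠ 0) : 0 < x₁ i j :=
    (ge_of_tendsto' (hentry i j) fun n => (hx _).nonneg i j).lt_of_ne' hij
  exact sub_eq_zero.1 (abs_nonpos_iff.1
    (nonpos_of_mul_nonpos_left hlimit (mul_pos (hpos hij) (hpos hkl))))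

variable [MeasurableSpace ι] [MeasurableSingletonClass ι] [MeasurableSpace κ]
  [MeasurableSingletonClass κ]

lemma isCoupling_measureReal_inter {F : I → ι} {G : I → κ} (hF : Measurable F)
    (hG : Measurable G) :
    IsCoupling (fun i j => volume.real (F ⁻¹' {i} ∩ G ⁻¹' {j})) (podeWeight F) (podeWeight G) := by
  have hFi i : MeasurableSet (F ⁻¹' {i}) := hF (MeasurableSet.singleton i)
  have hGj j : MeasurableSet (G ⁻¹' {j}) := hG (MeasurableSet.singleton j)
  refine ⟨fun i j => measureReal_nonneg, fun i => ?_, fun j => ?_⟩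
  · have hsum := sum_measureReal_preimage_singleton (μ := volume.restrict (F ⁻¹' {i})) (f := G)
      Finset.univ fun j _ => hGj j
    simpa [measureReal_restrict_apply, hGj, podeWeight, Set.inter_comm] using hsum
  · have hsum := sum_measureReal_preimage_singleton (μ := volume.restrict (G ⁻¹' {j})) (f := F)
      Finset.univ fun i _ => hFi i
    simpa [measureReal_restrict_apply, hFi, podeWeight] using hsum

/- Both values are within the cut distance of the integral of `g` over the common refinement. -/
lemma exists_isCoupling_of_cutDist_lt {g : I → I → ℝ} (hg : IsGraphon g) {q : I → ι} {q' : I → κ}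
    (hq : Measurable q) (hq' : Measurable q') {v : ι → ι → ℝ} {v' : κ → κ → ℝ}
    (hv : ∀ i k, v i k ∈ Set.Icc (0 : ℝ) 1) (hv' : ∀ j l, v' j l ∈ Set.Icc (0 : ℝ) 1) {r r' : ℝ}
    (h : cutDist g (step q v) < r) (h' : cutDist g (step q' v') < r') :
    ∃ x, IsCoupling x (podeWeight q) (podeWeight q') ∧
      ∀ i j k l, |v i k - v' j l| * (x i j * x k l) ≤ r + r' := by
  obtain ⟨φ, hφ, hφr⟩ := exists_labelledCutDist_lt_of_cutDist_lt h
  obtain ⟨ψ, hψ, hψr⟩ := exists_labelledCutDist_lt_of_cutDist_lt h'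
  have hF : Measurable (q ∘ φ) := hq.comp φ.measurable
  have hG : Measurable (q' ∘ ψ) := hq'.comp ψ.measurable
  refine ⟨_, podeWeight_comp hq hφ ▸ podeWeight_comp hq' hψ ▸ isCoupling_measureReal_inter hF hG,
    fun i j k l => ?_⟩
  have hmeas i j : MeasurableSet ((q ∘ φ) ⁻¹' {i} ∩ (q' ∘ ψ) ⁻¹' {j}) :=
    (hF (MeasurableSet.singleton i)).inter (hG (MeasurableSet.singleton j))
  have hle := (abs_setIntegral_sub_le_of_step hg (F := q ∘ φ) hv (hmeas i j) (hmeas k l)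
    (fun x hx => hx.1) fun y hy => hy.1).trans hφr.le
  have hle' := (abs_setIntegral_sub_le_of_step hg (F := q' ∘ ψ) hv' (hmeas i j) (hmeas k l)
    (fun x hx => hx.2) fun y hy => hy.2).trans hψr.le
  set s := volume.real ((q ∘ φ) ⁻¹' {i} ∩ (q' ∘ ψ) ⁻¹' {j})
  set t := volume.real ((q ∘ φ) ⁻¹' {k} ∩ (q' ∘ ψ) ⁻¹' {l})
  have hst : 0 ≤ s * t := mul_nonneg measureReal_nonneg measureReal_nonneg
  calc |v i k - v' j l| * (s * t) = |v i k * s * t - v' j l * s * t| := by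
        rw [mul_assoc, mul_assoc, ← sub_mul, abs_mul, abs_of_nonneg hst]
    _ ≤ r + r' := (abs_sub_le _ _ _).trans (add_le_add ((abs_sub_comm _ _).trans_le hle) hle')

end Coupling

/-! ### Tripodal optimizers that converge to a bipodal graphon -/

lemma bipodeSize_rev (c : ℝ) (i : Fin 2) : bipodeSize c i.rev = bipodeSize (1 - c) i := by
  fin_cases i <;> simp [bipodeSize]

lemma bipodeValue_rev (a b d : ℝ) (i j : Fin 2) :
    bipodeValue a b d i.rev j.rev = bipodeValue b a d i j := by
  fin_cases i <;> fin_cases j <;> rfl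

lemma IsB11.swap {a b c d : ℝ} (h : IsB11 a b c d) : IsB11 b a (1 - c) d where
  a_mem := h.b_mem
  b_mem := h.a_mem
  c_mem := ⟨by linarith [h.c_mem.2], by linarith [h.c_mem.1]⟩
  d_mem := h.d_mem
  not_constant h' := h.not_constant h'.symm
  not_A20 h' := h.not_A20 ⟨h'.1.symm, by linarith [h'.2]⟩

/- A pode that meets both podes of the bipodal graphon would force `a = b = d`. -/
lemma IsB11.eq_zero_or_eq_zero {ι : Type*} {a b c d : ℝ} (h : IsB11 a b c d)
    {x : ι → Fin 2 → ℝ} {v : ι → ι → ℝ}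
    (hv : ∀ i j k l, x i j ≠ 0 → x k l ≠ 0 → v i k = bipodeValue a b d j l) (i : ι) :
    x i 0 = 0 ∨ x i 1 = 0 := by
  by_contra! hi
  obtain ⟨h₀, h₁⟩ := hi
  have haa : v i i = a := hv i 0 i 0 h₀ h₀
  have had : v i i = d := hv i 0 i 1 h₀ h₁
  have hbb : v i i = b := hv i 1 i 1 h₁ h₁
  exact h.not_constant ⟨haa.symm.trans had, hbb.symm.trans had⟩

section Overlap

variable {ap am b c d a₀ b₀ c₀ d₀ : ℝ} {x : Fin 3 → Fin 2 → ℝ}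

lemma IsB11.merge_of_same_pode (h₀ : IsB11 a₀ b₀ c₀ d₀)
    (hx : IsCoupling x (podeSize c) (bipodeSize c₀))
    (hv : ∀ i j k l, x i j ≠ 0 → x k l ≠ 0 →
      podeValue ap am b d i k = bipodeValue a₀ b₀ d₀ j l) (h01 : x 0 1 = 0) (h11 : x 1 1 = 0) :
    ap = am ∧ IsB11 am b c d := by
  have hrow := hx.row_sum
  have hcol := hx.col_sum
  simp only [Fin.forall_fin_succ, Fin.sum_univ_two, Fin.sum_univ_three, podeSize, bipodeSize,
    Matrix.cons_val, IsEmpty.forall_iff, Fin.succ_zero_eq_one,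
    Fin.succ_one_eq_two, and_true] at hrow hcol
  have h21 : x 2 1 ≠ 0 := fun h => by linarith [h₀.c_mem.2]
  have h20 : x 2 0 = 0 := (h₀.eq_zero_or_eq_zero hv 2).resolve_right h21
  have hc : c = c₀ := by linarith
  have h00 : x 0 0 ≠ 0 := fun h => by linarith [h₀.c_mem.1]
  have h10 : x 1 0 ≠ 0 := fun h => by linarith [h₀.c_mem.1]
  have ham : am = a₀ := hv 0 0 0 0 h00 h00
  have hap : ap = a₀ := hv 0 0 1 0 h00 h10
  have hd : d = d₀ := hv 0 0 2 1 h00 h21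
  have hb : b = b₀ := hv 2 1 2 1 h21 h21
  exact ⟨hap.trans ham.symm, by rwa [ham, hb, hc, hd]⟩

lemma IsB11.not_different_podes (h₀ : IsB11 a₀ b₀ c₀ d₀)
    (hx : IsCoupling x (podeSize c) (bipodeSize c₀))
    (hv : ∀ i j k l, x i j ≠ 0 → x k l ≠ 0 →
      podeValue ap am b d i k = bipodeValue a₀ b₀ d₀ j l) (h01 : x 0 1 = 0) : x 1 0 ≠ 0 := by
  intro h10
  have hrow := hx.row_sum
  have hcol := hx.col_sum
  simp only [Fin.forall_fin_succ, Fin.sum_univ_two, Fin.sum_univ_three, podeSize, bipodeSize,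
    Matrix.cons_val, IsEmpty.forall_iff, Fin.succ_zero_eq_one,
    Fin.succ_one_eq_two, and_true] at hrow hcol
  have hsingle := h₀.eq_zero_or_eq_zero hv 2
  have hc : c ≠ 0 := fun h => by
    rcases hsingle with h2 | h2 <;> linarith [h₀.c_mem.1, h₀.c_mem.2]
  have h00 : x 0 0 ≠ 0 := fun h => hc (by linarith)
  have h11 : x 1 1 ≠ 0 := fun h => hc (by linarith)
  have ha₀ : am = a₀ := hv 0 0 0 0 h00 h00
  have hb₀ : am = b₀ := hv 1 1 1 1 h11 h11
  by_cases h20 : x 2 0 = 0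
  · by_cases h21 : x 2 1 = 0
    · exact h₀.not_A20 ⟨ha₀.symm.trans hb₀, by linarith⟩
    · have hd₀ : d = d₀ := hv 0 0 2 1 h00 h21
      have hd : d = b₀ := hv 1 1 2 1 h11 h21
      exact h₀.not_constant ⟨by linarith, by linarith⟩
  · have hd : d = a₀ := hv 0 0 2 0 h00 h20
    have hd₀ : d = d₀ := hv 1 1 2 0 h11 h20
    exact h₀.not_constant ⟨by linarith, by linarith⟩

lemma IsB11.merge_of_isCoupling (h₀ : IsB11 a₀ b₀ c₀ d₀)
    (hx : IsCoupling x (podeSize c) (bipodeSize c₀))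
    (hv : ∀ i j k l, x i j ≠ 0 → x k l ≠ 0 →
      podeValue ap am b d i k = bipodeValue a₀ b₀ d₀ j l) :
    ap = am ∧ IsB11 am b c d := by
  wlog h01 : x 0 1 = 0 generalizing a₀ b₀ c₀ x
  · refine this h₀.swap (x := fun i j => x i j.rev)
      ⟨fun i j => hx.nonneg i _, fun i => ?_, fun j => ?_⟩
      (fun i j k l hij hkl => ?_) ((h₀.eq_zero_or_eq_zero hv 0).resolve_right h01)
    · rw [← hx.row_sum i]
      exact Equiv.sum_comp Fin.revPerm (x i)
    · rw [← bipodeSize_rev]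
      exact hx.col_sum j.rev
    · rw [← bipodeValue_rev]
      exact hv i _ k _ hij hkl
  exact h₀.merge_of_same_pode hx hv h01
    ((h₀.eq_zero_or_eq_zero hv 1).resolve_left (h₀.not_different_podes hx hv h01))

end Overlap

lemma exists_eq_podeSize_of_tendsto {α : Type*} {l : Filter α} [l.NeBot] {c : α → ℝ}
    {w : Fin 3 → ℝ} (h : Tendsto (fun t => podeSize (c t)) l (𝓝 w)) :
    ∃ c₀, w = podeSize c₀ ∧ Tendsto c l (𝓝 c₀) := by
  have hentry := tendsto_pi_nhds.1 h
  have hc : Tendsto c l (𝓝 (1 - w 2)) := by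
    simpa [podeSize] using (hentry 2).const_sub 1
  refine ⟨_, funext fun i => tendsto_nhds_unique (hentry i) ?_, hc⟩
  fin_cases i
  exacts [hc.div_const 2, hc.div_const 2, hc.const_sub 1]

lemma tendsto_podeValue {α : Type*} {l : Filter α} {ap am b d : α → ℝ} {ap₀ am₀ b₀ d₀ : ℝ}
    (hap : Tendsto ap l (𝓝 ap₀)) (ham : Tendsto am l (𝓝 am₀)) (hb : Tendsto b l (𝓝 b₀))
    (hd : Tendsto d l (𝓝 d₀)) (i j : Fin 3) :
    Tendsto (fun t => podeValue (ap t) (am t) (b t) (d t) i j) l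
      (𝓝 (podeValue ap₀ am₀ b₀ d₀ i j)) := by
  fin_cases i <;> fin_cases j <;> assumption

lemma exists_eq_podeValue_of_tendsto {α : Type*} {l : Filter α} [l.NeBot] {ap am b d : α → ℝ}
    {v : Fin 3 → Fin 3 → ℝ} (h : Tendsto (fun t => podeValue (ap t) (am t) (b t) (d t)) l (𝓝 v)) :
    ∃ ap₀ am₀ b₀ d₀, v = podeValue ap₀ am₀ b₀ d₀ ∧ Tendsto ap l (𝓝 ap₀) ∧
      Tendsto am l (𝓝 am₀) ∧ Tendsto b l (𝓝 b₀) ∧ Tendsto d l (𝓝 d₀) := by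
  have hentry i j := tendsto_pi_nhds.1 (tendsto_pi_nhds.1 h i) j
  exact ⟨_, _, _, _, funext fun i => funext fun j => tendsto_nhds_unique (hentry i j)
    (tendsto_podeValue (hentry 0 1) (hentry 0 0) (hentry 2 2) (hentry 0 2) i j),
    hentry 0 1, hentry 0 0, hentry 2 2, hentry 0 2⟩

/-- A sequence of tripodal optimizers with Lagrange multipliers `α` and `β` in which the first two
podes merge, and whose limit is of type `B(1,1)`. -/
structure IsMergingSequence (ap am b c d α β : ℕ → ℝ) (a₀ b₀ c₀ d₀ : ℝ) : Prop where
  ne : ∀ n, ap n ≠ am n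
  c_mem : ∀ n, c n ∈ Set.Ioo (0 : ℝ) 1
  critical : ∀ n, IsCriticalStep (podeSize (c n)) ![1 / 2, 1 / 2, -1]
    (podeValue (ap n) (am n) (b n) (d n)) (α n) (β n)
  maximal : ∀ n, IsMaximalTripodal (ap n) (am n) (b n) (c n) (d n)
  limit : IsB11 a₀ b₀ c₀ d₀
  tendsto_ap : Tendsto ap atTop (𝓝 a₀)
  tendsto_am : Tendsto am atTop (𝓝 a₀)
  tendsto_b : Tendsto b atTop (𝓝 b₀)
  tendsto_c : Tendsto c atTop (𝓝 c₀)
  tendsto_d : Tendsto d atTop (𝓝 d₀)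

lemma IsB21orC12.podeSize_mem {ap am b c d : ℝ} (h : IsB21orC12 ap am b c d) (i : Fin 3) :
    podeSize c i ∈ Set.Icc (0 : ℝ) 1 := by
  refine ⟨(podeSize_pos h.c_mem i).le, ?_⟩
  fin_cases i <;> simp only [podeSize, Fin.zero_eta, Fin.mk_one, Fin.reduceFinMk,
    Matrix.cons_val] <;> linarith [h.c_mem.1, h.c_mem.2]

lemma exists_isMergingSequence {V : Set (ℝ × ℝ)} (hV : IsB21orC12Phase V) {p₀ : ℝ × ℝ}
    {a₀ b₀ c₀ d₀ : ℝ} (h₀ : IsB11 a₀ b₀ c₀ d₀)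
    (hlim : IsLimitOfOptimizers V p₀ (bipodal a₀ b₀ c₀ d₀)) :
    ∃ (ap am b c d α β : ℕ → ℝ) (a₁ b₁ c₁ d₁ : ℝ),
      IsMergingSequence ap am b c d α β a₁ b₁ c₁ d₁ := by
  obtain ⟨p, g, hpV, hg, -, hcut⟩ := hlim
  choose ap am b c d α β htype hopt hcritical using fun n => hV.exists_isCriticalStep (hpV n)
  have hvalue n := podeValue_mem (htype n).ap_mem (htype n).am_mem (htype n).b_mem (htype n).d_mem
  have hc n := Set.Ioo_subset_Icc_self (htype n).c_mem
  let r : ℕ → ℝ := fun n => 1 / (n + 1)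
  have hr_pos n : 0 < r n := by positivity
  have hr : Tendsto r atTop (𝓝 0) := tendsto_one_div_add_atTop_nhds_zero_nat
  choose x hx hclose using fun n => exists_isCoupling_of_cutDist_lt (hg n).isGraphon
    (measurable_podeIndex (c n)) (measurable_bipodeIndex c₀) (hvalue n)
    (bipodeValue_mem h₀.a_mem h₀.b_mem h₀.d_mem) (r := r n)
    (r' := cutDist (g n) (bipodal a₀ b₀ c₀ d₀) + r n)
    (by rw [← tripodal_eq_step, (hopt n).2 _ (hg n)]; exact hr_pos n)
    (by rw [← bipodal_eq_step]; linarith [hr_pos n])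
  simp only [podeWeight_podeIndex (hc _),
    podeWeight_bipodeIndex (Set.Ioo_subset_Icc_self h₀.c_mem)] at hx
  obtain ⟨φ, w₁, v₁, x₁, -, hw₁, hv₁, hx₁, hmatch⟩ := exists_subseq_tendsto_isCoupling
    (by simpa using hr.add (hcut.add hr)) (fun n => (htype n).podeSize_mem) hvalue hx hclose
  obtain ⟨c₁, rfl, hc₁⟩ := exists_eq_podeSize_of_tendsto hw₁
  obtain ⟨ap₁, am₁, b₁, d₁, rfl, hap, ham, hb, hd⟩ := exists_eq_podeValue_of_tendsto hv₁
  obtain ⟨rfl, hB₁⟩ := h₀.merge_of_isCoupling hx₁ hmatch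
  exact ⟨_, _, _, _, _, α ∘ φ, β ∘ φ, _, _, _, _,
    { ne := fun n => (htype _).ne
      c_mem := fun n => (htype _).c_mem
      critical := fun n => hcritical _
      maximal := fun n => (hopt (φ n)).1.isMaximalTripodal (hV.below _ (hpV _)).le (hc _)
      limit := hB₁
      tendsto_ap := hap
      tendsto_am := ham
      tendsto_b := hb
      tendsto_c := hc₁
      tendsto_d := hd }⟩

/-! ### Necessary conditions on the limit of a merging sequence -/

section CriticalLimit

lemma eq_zero_or_eq_one_of_tendsto {u v K L α β : ℕ → ℝ} {u₀ v₀ k l : ℝ}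
    (hu : ∀ n, u n ∈ Set.Ioo (0 : ℝ) 1) (hv : ∀ n, v n ∈ Set.Ioo (0 : ℝ) 1)
    (hslope_u : ∀ n, entropySlope (u n) = 2 * α n + 6 * β n * K n)
    (hslope_v : ∀ n, entropySlope (v n) = 2 * α n + 6 * β n * L n)
    (hβ : Tendsto β atTop atTop) (hu₀ : Tendsto u atTop (𝓝 u₀)) (hv₀ : Tendsto v atTop (𝓝 v₀))
    (hK : Tendsto K atTop (𝓝 k)) (hL : Tendsto L atTop (𝓝 l)) (hlk : l < k) :
    u₀ = 0 ∨ v₀ = 1 := by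
  by_contra! hne
  have hu₀_pos : 0 < u₀ := (ge_of_tendsto' hu₀ fun n => (hu n).1.le).lt_of_ne' hne.1
  have hv₀_lt : v₀ < 1 := (le_of_tendsto' hv₀ fun n => (hv n).2.le).lt_of_ne hne.2
  have hdiverge : Tendsto (fun n => 6 * β n * (K n - L n)) atTop atTop :=
    (hβ.const_mul_atTop (by norm_num)).atTop_mul_pos (sub_pos.2 hlk) (hK.sub hL)
  have hbounded : Tendsto (fun n => -Real.log (u n) - Real.log (1 - v n)) atTop
      (𝓝 (-Real.log u₀ - Real.log (1 - v₀))) :=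
    (hu₀.log hu₀_pos.ne').neg.sub ((hv₀.const_sub 1).log (sub_pos.2 hv₀_lt).ne')
  obtain ⟨n, hlarge, hsmall⟩ := ((hdiverge.eventually_gt_atTop
    (-Real.log u₀ - Real.log (1 - v₀) + 1)).and
    (hbounded.eventually (gt_mem_nhds (lt_add_one _)))).exists
  have hlog_u : Real.log (1 - u n) ≤ 0 :=
    Real.log_nonpos (by linarith [(hu n).2]) (by linarith [(hu n).1])
  have hlog_v : Real.log (v n) ≤ 0 := Real.log_nonpos (hv n).1.le (hv n).2.le
  have heq_u := hslope_u n
  have heq_v := hslope_v n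
  unfold entropySlope at heq_u heq_v
  linarith

lemma eq_zero_of_tendsto_mul {β f : ℕ → ℝ} {x y : ℝ} (hβ : Tendsto β atTop atTop)
    (hf : Tendsto f atTop (𝓝 x)) (hβf : Tendsto (fun n => β n * f n) atTop (𝓝 y)) : x = 0 := by
  have hquot := (tendsto_inv_atTop_zero.comp hβ).mul hβf
  rw [zero_mul] at hquot
  refine tendsto_nhds_unique hf (hquot.congr' ?_)
  filter_upwards [hβ.eventually_ne_atTop 0] with n hn
  exact inv_mul_cancel_left₀ hn (f n)

variable {ι : Type*} [Fintype ι]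

lemma tendsto_codegree {w : ℕ → ι → ℝ} {v : ℕ → ι → ι → ℝ} {w₀ : ι → ℝ} {v₀ : ι → ι → ℝ}
    (hw : ∀ i, Tendsto (fun n => w n i) atTop (𝓝 (w₀ i)))
    (hv : ∀ i j, Tendsto (fun n => v n i j) atTop (𝓝 (v₀ i j))) (i j : ι) :
    Tendsto (fun n => codegree (w n) (v n) i j) atTop (𝓝 (codegree w₀ v₀ i j)) :=
  tendsto_finsetSum _ fun k _ => (hw k).mul ((hv i k).mul (hv k j))

lemma tendsto_blockSum {w : ℕ → ι → ℝ} {f : ℕ → ι → ι → ℝ} {w₀ : ι → ℝ} {f₀ : ι → ι → ℝ}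
    (w' : ι → ℝ) (hw : ∀ i, Tendsto (fun n => w n i) atTop (𝓝 (w₀ i)))
    (hf : ∀ i j, Tendsto (fun n => f n i j) atTop (𝓝 (f₀ i j))) :
    Tendsto (fun n => blockSum w' (w n) (f n)) atTop (𝓝 (blockSum w' w₀ f₀)) :=
  tendsto_finsetSum _ fun i _ => tendsto_finsetSum _ fun j _ => ((hw j).const_mul _).mul (hf i j)

section Densities

variable {w : ℕ → ι → ℝ} {v : ℕ → ι → ι → ℝ} {w₀ : ι → ℝ} {v₀ : ι → ι → ℝ}

lemma tendsto_stepEdge (hw : ∀ i, Tendsto (fun n => w n i) atTop (𝓝 (w₀ i)))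
    (hv : ∀ i j, Tendsto (fun n => v n i j) atTop (𝓝 (v₀ i j))) :
    Tendsto (fun n => stepEdge (w n) (v n)) atTop (𝓝 (stepEdge w₀ v₀)) :=
  tendsto_finsetSum _ fun i _ => tendsto_finsetSum _ fun j _ => ((hw i).mul (hw j)).mul (hv i j)

lemma tendsto_stepTriangle (hw : ∀ i, Tendsto (fun n => w n i) atTop (𝓝 (w₀ i)))
    (hv : ∀ i j, Tendsto (fun n => v n i j) atTop (𝓝 (v₀ i j))) :
    Tendsto (fun n => stepTriangle (w n) (v n)) atTop (𝓝 (stepTriangle w₀ v₀)) :=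
  tendsto_finsetSum _ fun i _ => tendsto_finsetSum _ fun j _ => tendsto_finsetSum _ fun k _ =>
    (((hw i).mul (hw j)).mul (hw k)).mul (((hv i j).mul (hv j k)).mul (hv k i))

lemma tendsto_stepEntropy (hw : ∀ i, Tendsto (fun n => w n i) atTop (𝓝 (w₀ i)))
    (hv : ∀ i j, Tendsto (fun n => v n i j) atTop (𝓝 (v₀ i j))) :
    Tendsto (fun n => stepEntropy (w n) (v n)) atTop (𝓝 (stepEntropy w₀ v₀)) :=
  (tendsto_stepEdge hw fun i j => (Real.binEntropy_continuous.tendsto _).comp (hv i j)).div_const 2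

end Densities

variable {w : ℕ → ι → ℝ} {w' : ι → ℝ} {v : ℕ → ι → ι → ℝ} {α β : ℕ → ℝ} {w₀ : ι → ℝ}
  {v₀ : ι → ι → ℝ}

lemma IsCriticalStep.eq_zero_or_eq_one_of_codegree_lt
    (h : ∀ n, IsCriticalStep (w n) w' (v n) (α n) (β n)) (hβ : Tendsto β atTop atTop)
    (hw : ∀ i, Tendsto (fun n => w n i) atTop (𝓝 (w₀ i)))
    (hv : ∀ i j, Tendsto (fun n => v n i j) atTop (𝓝 (v₀ i j))) {i j k l : ι}
    (hlt : codegree w₀ v₀ k l < codegree w₀ v₀ i j) : v₀ i j = 0 ∨ v₀ k l = 1 :=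
  eq_zero_or_eq_one_of_tendsto (fun n => (h n).mem_Ioo i j) (fun n => (h n).mem_Ioo k l)
    (fun n => (h n).slope i j) (fun n => (h n).slope k l) hβ (hv i j) (hv k l)
    (tendsto_codegree hw hv i j) (tendsto_codegree hw hv k l) hlt

/- Eliminating `α` from the stationarity in the pode sizes with the slope at an interior value
leaves a bounded multiple of `β`. -/
lemma IsCriticalStep.blockSum_mul_codegree_eq
    (h : ∀ n, IsCriticalStep (w n) w' (v n) (α n) (β n)) (hβ : Tendsto β atTop atTop)
    (hw : ∀ i, Tendsto (fun n => w n i) atTop (𝓝 (w₀ i)))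
    (hv : ∀ i j, Tendsto (fun n => v n i j) atTop (𝓝 (v₀ i j))) {i j : ι}
    (hmem : v₀ i j ∈ Set.Ioo (0 : ℝ) 1) :
    blockSum w' w₀ (fun k l => v₀ k l * codegree w₀ v₀ k l) =
      2 * codegree w₀ v₀ i j * blockSum w' w₀ v₀ := by
  have hκ := tendsto_codegree hw hv
  have hedge := tendsto_blockSum w' hw hv
  have htriangle := tendsto_blockSum w' hw fun k l => (hv k l).mul (hκ k l)
  have hentropy := tendsto_blockSum w' hw fun k l =>
    (Real.binEntropy_continuous.tendsto _).comp (hv k l)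
  have hslope := (continuousAt_entropySlope hmem).tendsto.comp (hv i j)
  refine sub_eq_zero.1 (eq_zero_of_tendsto_mul hβ
    (htriangle.sub (((hκ i j).const_mul 2).mul hedge))
    (((hentropy.sub (hslope.mul hedge)).div_const 3).congr fun n => ?_))
  simp only [Function.comp_def, (h n).size, (h n).slope]
  ring

end CriticalLimit

section Merging

/-- The relabelling of podes that merges the two interchangeable podes of a tripodal graphon. -/
def merge : Fin 3 → Fin 2 := ![0, 0, 1]

lemma podeValue_merge (a b d : ℝ) (i j : Fin 3) :
    podeValue a a b d i j = bipodeValue a b d (merge i) (merge j) := by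
  fin_cases i <;> fin_cases j <;> rfl

lemma merge_surjective : Function.Surjective merge := by decide

lemma codegree_podeValue (a b c d : ℝ) (i j : Fin 3) :
    codegree (podeSize c) (podeValue a a b d) i j =
      codegree (bipodeSize c) (bipodeValue a b d) (merge i) (merge j) := by
  simp only [codegree, podeValue_merge, Fin.sum_univ_three, Fin.sum_univ_two, podeSize, bipodeSize,
    merge, Matrix.cons_val]
  ring

lemma blockSum_podeSize (c : ℝ) (f : Fin 2 → Fin 2 → ℝ) :
    blockSum ![1 / 2, 1 / 2, -1] (podeSize c) (fun i j => f (merge i) (merge j)) =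
      blockSum ![1, -1] (bipodeSize c) f := by
  simp only [blockSum, Fin.sum_univ_three, Fin.sum_univ_two, podeSize, bipodeSize, merge,
    Matrix.cons_val]
  ring

lemma codegree_bipodeValue_rev (a b c d : ℝ) (i j : Fin 2) :
    codegree (bipodeSize c) (bipodeValue a b d) i.rev j.rev =
      codegree (bipodeSize (1 - c)) (bipodeValue b a d) i j := by
  simp only [codegree, ← bipodeValue_rev a b d, ← bipodeSize_rev c]
  exact (Equiv.sum_comp Fin.revPerm fun k => bipodeSize c k *
    (bipodeValue a b d i.rev k * bipodeValue a b d k j.rev)).symm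

lemma blockSum_bipodeSize_rev (c : ℝ) (f : Fin 2 → Fin 2 → ℝ) :
    blockSum ![1, -1] (bipodeSize (1 - c)) (fun i j => f i.rev j.rev) =
      -blockSum ![1, -1] (bipodeSize c) f := by
  simp only [blockSum, bipodeSize, Fin.sum_univ_two, Fin.rev_zero, Fin.reduceLast, Fin.reduceRev,
    Fin.isValue, Matrix.cons_val]
  ring

end Merging

/-- Necessary conditions on a bipodal graphon that is the limit of tripodal optimizers with
unbounded Lagrange multipliers. Its entropy is not exceeded by a competitor with strictly fewer
triangles, nor by the bipartite competitor with the same edge density. -/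
structure IsCriticalBipodal (a b c d : ℝ) : Prop where
  isB11 : IsB11 a b c d
  eq_zero_or_eq_one : ∀ i j k l : Fin 2,
    codegree (bipodeSize c) (bipodeValue a b d) k l <
      codegree (bipodeSize c) (bipodeValue a b d) i j →
    bipodeValue a b d i j = 0 ∨ bipodeValue a b d k l = 1
  size : ∀ i j : Fin 2, bipodeValue a b d i j ∈ Set.Ioo (0 : ℝ) 1 →
    blockSum ![1, -1] (bipodeSize c)
        (fun k l => bipodeValue a b d k l * codegree (bipodeSize c) (bipodeValue a b d) k l) =
      2 * codegree (bipodeSize c) (bipodeValue a b d) i j *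
        blockSum ![1, -1] (bipodeSize c) (bipodeValue a b d)
  maximal : ∀ ap' am' b' c' d' : ℝ, ap' ∈ Set.Icc (0 : ℝ) 1 → am' ∈ Set.Icc (0 : ℝ) 1 →
    b' ∈ Set.Icc (0 : ℝ) 1 → c' ∈ Set.Icc (0 : ℝ) 1 → d' ∈ Set.Icc (0 : ℝ) 1 →
    triEdge ap' am' b' c' d' = triEdge a a b c d →
    triTriangle ap' am' b' c' d' < triTriangle a a b c d →
    triEntropy ap' am' b' c' d' ≤ triEntropy a a b c d
  bipartite : triEdge a a b c d < 1 / 2 →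
    Real.binEntropy (2 * triEdge a a b c d) / 4 ≤ triEntropy a a b c d

lemma IsCriticalBipodal.swap {a b c d : ℝ} (h : IsCriticalBipodal a b c d) :
    IsCriticalBipodal b a (1 - c) d := by
  have hedge : triEdge b b a (1 - c) d = triEdge a a b c d := by simp only [triEdge_eq]; ring
  have htriangle : triTriangle b b a (1 - c) d = triTriangle a a b c d := by
    simp only [triTriangle_eq]; ring
  have hentropy : triEntropy b b a (1 - c) d = triEntropy a a b c d := by
    simp only [triEntropy_eq]; ring
  refine ⟨h.isB11.swap, fun i j k l hlt => ?_, fun i j hmem => ?_, ?_, ?_⟩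
  · simp only [← codegree_bipodeValue_rev, ← bipodeValue_rev a b d] at hlt ⊢
    exact h.eq_zero_or_eq_one _ _ _ _ hlt
  · simp only [← codegree_bipodeValue_rev, ← bipodeValue_rev a b d] at hmem ⊢
    have hvalue : bipodeValue b a d = fun i j => bipodeValue a b d i.rev j.rev :=
      funext₂ fun i j => (bipodeValue_rev a b d i j).symm
    rw [hvalue, blockSum_bipodeSize_rev c fun i j => bipodeValue a b d i j *
      codegree (bipodeSize c) (bipodeValue a b d) i j, blockSum_bipodeSize_rev,
      h.size _ _ hmem, mul_neg]
  · rw [hedge, htriangle, hentropy]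
    exact h.maximal
  · rw [hedge, hentropy]
    exact h.bipartite

lemma triEdge_pos {a b c d : ℝ} (ha : 0 ≤ a) (hb : 0 ≤ b) (hc : c ∈ Set.Ioo (0 : ℝ) 1)
    (hd : 0 ≤ d) (hne : ¬ (a = d ∧ b = d)) : 0 < triEdge a a b c d := by
  obtain ⟨hc₀, hc₁⟩ := hc
  have : 0 < 1 - c := sub_pos.2 hc₁
  have hpos : 0 < a ∨ 0 < b ∨ 0 < d := by
    by_contra! h
    exact hne ⟨by linarith, by linarith⟩
  rw [triEdge_eq]
  rcases hpos with hpos | hpos | hpos <;> positivity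

lemma IsB11.triEdge_mem_Ioo {a b c d : ℝ} (h : IsB11 a b c d) :
    triEdge a a b c d ∈ Set.Ioo (0 : ℝ) 1 := by
  refine ⟨triEdge_pos h.a_mem.1 h.b_mem.1 h.c_mem h.d_mem.1 h.not_constant, ?_⟩
  have hcompl : triEdge (1 - a) (1 - a) (1 - b) c (1 - d) = 1 - triEdge a a b c d := by
    simp only [triEdge_eq]
    ring
  rw [← sub_pos, ← hcompl]
  exact triEdge_pos (sub_nonneg.2 h.a_mem.2) (sub_nonneg.2 h.b_mem.2) h.c_mem
    (sub_nonneg.2 h.d_mem.2) fun hc => h.not_constant ⟨by linarith [hc.1], by linarith [hc.2]⟩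

lemma triEdge_const_add_mul_sub (ap am b c d s e E : ℝ) :
    triEdge (E + s * (ap - e)) (E + s * (am - e)) (E + s * (b - e)) c (E + s * (d - e)) =
      E + s * (triEdge ap am b c d - e) := by
  simp only [triEdge_eq]
  ring

lemma triTriangle_nonneg {ap am b c d : ℝ} (hap : 0 ≤ ap) (ham : 0 ≤ am) (hb : 0 ≤ b)
    (hc : c ∈ Set.Icc (0 : ℝ) 1) : 0 ≤ triTriangle ap am b c d := by
  have hc₀ := hc.1
  have hc₁ := sub_nonneg.2 hc.2
  have hcube : (am + ap) ^ 3 + (am - ap) ^ 3 = 2 * am ^ 3 + 6 * am * ap ^ 2 := by ring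
  rw [triTriangle_eq, hcube]
  positivity

/- The unit interval is contracted towards `e` just enough for its translate by `E n - e` to stay
inside the unit interval. -/
lemma exists_tendsto_one_of_tendsto {E : ℕ → ℝ} {e : ℝ} (he : e ∈ Set.Ioo (0 : ℝ) 1)
    (hmem : ∀ n, E n ∈ Set.Icc (0 : ℝ) 1) (hE : Tendsto E atTop (𝓝 e)) :
    ∃ s : ℕ → ℝ, Tendsto s atTop (𝓝 1) ∧
      ∀ n, ∀ u ∈ Set.Icc (0 : ℝ) 1, E n + s n * (u - e) ∈ Set.Icc (0 : ℝ) 1 := by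
  obtain ⟨he₀, he₁⟩ := he
  have he₁' : 0 < 1 - e := sub_pos.2 he₁
  refine ⟨fun n => min (E n / e) ((1 - E n) / (1 - e)), ?_, fun n u hu => ?_⟩
  · have hleft := hE.div_const e
    have hright := (hE.const_sub 1).div_const (1 - e)
    rw [div_self he₀.ne'] at hleft
    rw [div_self he₁'.ne'] at hright
    simpa using hleft.min hright
  · set s := min (E n / e) ((1 - E n) / (1 - e))
    have hs : 0 ≤ s := le_min (div_nonneg (hmem n).1 he₀.le)
      (div_nonneg (sub_nonneg.2 (hmem n).2) he₁'.le)
    have hleft : s * e ≤ E n := (le_div_iff₀ he₀).1 (min_le_left _ _)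
    have hright : s * (1 - e) ≤ 1 - E n := (le_div_iff₀ he₁').1 (min_le_right _ _)
    constructor <;> linarith [mul_nonneg hs hu.1, mul_le_mul_of_nonneg_left hu.2 hs]

lemma tendsto_podeSize {c : ℕ → ℝ} {c₀ : ℝ} (hc : Tendsto c atTop (𝓝 c₀)) (i : Fin 3) :
    Tendsto (fun n => podeSize (c n) i) atTop (𝓝 (podeSize c₀ i)) := by
  fin_cases i
  exacts [hc.div_const 2, hc.div_const 2, hc.const_sub 1]

section Limits

variable {ap am b c d : ℕ → ℝ} {ap₀ am₀ b₀ c₀ d₀ : ℝ}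

lemma tendsto_triEdge (hap : Tendsto ap atTop (𝓝 ap₀)) (ham : Tendsto am atTop (𝓝 am₀))
    (hb : Tendsto b atTop (𝓝 b₀)) (hc : Tendsto c atTop (𝓝 c₀)) (hd : Tendsto d atTop (𝓝 d₀)) :
    Tendsto (fun n => triEdge (ap n) (am n) (b n) (c n) (d n)) atTop
      (𝓝 (triEdge ap₀ am₀ b₀ c₀ d₀)) :=
  tendsto_stepEdge (tendsto_podeSize hc) (tendsto_podeValue hap ham hb hd)

lemma tendsto_triTriangle (hap : Tendsto ap atTop (𝓝 ap₀)) (ham : Tendsto am atTop (𝓝 am₀))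
    (hb : Tendsto b atTop (𝓝 b₀)) (hc : Tendsto c atTop (𝓝 c₀)) (hd : Tendsto d atTop (𝓝 d₀)) :
    Tendsto (fun n => triTriangle (ap n) (am n) (b n) (c n) (d n)) atTop
      (𝓝 (triTriangle ap₀ am₀ b₀ c₀ d₀)) :=
  tendsto_stepTriangle (tendsto_podeSize hc) (tendsto_podeValue hap ham hb hd)

lemma tendsto_triEntropy (hap : Tendsto ap atTop (𝓝 ap₀)) (ham : Tendsto am atTop (𝓝 am₀))
    (hb : Tendsto b atTop (𝓝 b₀)) (hc : Tendsto c atTop (𝓝 c₀)) (hd : Tendsto d atTop (𝓝 d₀)) :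
    Tendsto (fun n => triEntropy (ap n) (am n) (b n) (c n) (d n)) atTop
      (𝓝 (triEntropy ap₀ am₀ b₀ c₀ d₀)) :=
  tendsto_stepEntropy (tendsto_podeSize hc) (tendsto_podeValue hap ham hb hd)

end Limits

namespace IsMergingSequence

variable {ap am b c d α β : ℕ → ℝ} {a₀ b₀ c₀ d₀ : ℝ}

lemma inv_le_multiplier (h : IsMergingSequence ap am b c d α β a₀ b₀ c₀ d₀) (n : ℕ) :
    (3 * |am n - ap n|)⁻¹ ≤ β n := by
  have hcrit := h.critical n
  have hgap : 0 < |am n - ap n| := abs_pos.2 (sub_ne_zero.2 (h.ne n).symm)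
  have hslope : entropySlope (ap n) - entropySlope (am n) =
      -(3 * β n * c n * (am n - ap n) ^ 2) := by
    have hap := hcrit.slope 0 1
    have ham := hcrit.slope 0 0
    simp only [codegree, podeSize, podeValue, Fin.sum_univ_three, Matrix.cons_val] at hap ham
    rw [hap, ham]
    ring
  have hsq := sq_sub_le_entropySlope_sub_mul (hcrit.mem_Ioo 0 1) (hcrit.mem_Ioo 0 0)
  simp only [podeValue, Matrix.cons_val] at hsq
  rw [hslope] at hsq
  have hcube : -(am n - ap n) ^ 3 ≤ |am n - ap n| ^ 3 := by
    rw [← abs_pow]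
    exact neg_le_abs _
  have hfactor : 0 ≤ 3 * β n * c n :=
    mul_nonneg (mul_nonneg zero_le_three hcrit.nonneg) (h.c_mem n).1.le
  have hone : 1 ≤ 3 * β n * c n * |am n - ap n| := by
    refine le_of_mul_le_mul_left ?_ (pow_pos hgap 2)
    calc |am n - ap n| ^ 2 * 1 = (ap n - am n) ^ 2 := by rw [mul_one, sq_abs]; ring
      _ ≤ -(3 * β n * c n * (am n - ap n) ^ 2) * (am n - ap n) := hsq
      _ = 3 * β n * c n * -(am n - ap n) ^ 3 := by ring
      _ ≤ 3 * β n * c n * |am n - ap n| ^ 3 := mul_le_mul_of_nonneg_left hcube hfactor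
      _ = |am n - ap n| ^ 2 * (3 * β n * c n * |am n - ap n|) := by ring
  rw [inv_le_iff_one_le_mul₀ (mul_pos three_pos hgap)]
  nlinarith [mul_nonneg hcrit.nonneg hgap.le, (h.c_mem n).2]

lemma tendsto_multiplier (h : IsMergingSequence ap am b c d α β a₀ b₀ c₀ d₀) :
    Tendsto β atTop atTop := by
  have hgap : Tendsto (fun n => 3 * |am n - ap n|) atTop (𝓝[>] 0) := by
    refine tendsto_nhdsWithin_iff.2 ⟨?_, Eventually.of_forall fun n =>
      mul_pos three_pos (abs_pos.2 (sub_ne_zero.2 (h.ne n).symm))⟩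
    simpa using (h.tendsto_am.sub h.tendsto_ap).abs.const_mul 3
  exact tendsto_atTop_mono h.inv_le_multiplier (tendsto_inv_nhdsGT_zero.comp hgap)

lemma ap_mem (h : IsMergingSequence ap am b c d α β a₀ b₀ c₀ d₀) (n : ℕ) :
    ap n ∈ Set.Ioo (0 : ℝ) 1 := (h.critical n).mem_Ioo 0 1

lemma am_mem (h : IsMergingSequence ap am b c d α β a₀ b₀ c₀ d₀) (n : ℕ) :
    am n ∈ Set.Ioo (0 : ℝ) 1 := (h.critical n).mem_Ioo 0 0

lemma b_mem (h : IsMergingSequence ap am b c d α β a₀ b₀ c₀ d₀) (n : ℕ) :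
    b n ∈ Set.Ioo (0 : ℝ) 1 := (h.critical n).mem_Ioo 2 2

lemma triEdge_mem (h : IsMergingSequence ap am b c d α β a₀ b₀ c₀ d₀) (n : ℕ) :
    triEdge (ap n) (am n) (b n) (c n) (d n) ∈ Set.Icc (0 : ℝ) 1 := by
  refine stepEdge_mem (fun i => (podeSize_pos (h.c_mem n) i).le) ?_
    fun i j => Set.Ioo_subset_Icc_self ((h.critical n).mem_Ioo i j)
  simp only [podeSize, Fin.sum_univ_three, Matrix.cons_val]
  ring

lemma tendsto_triEdge (h : IsMergingSequence ap am b c d α β a₀ b₀ c₀ d₀) :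
    Tendsto (fun n => triEdge (ap n) (am n) (b n) (c n) (d n)) atTop
      (𝓝 (triEdge a₀ a₀ b₀ c₀ d₀)) :=
  EdgeTriangle.tendsto_triEdge h.tendsto_ap h.tendsto_am h.tendsto_b h.tendsto_c h.tendsto_d

lemma tendsto_triTriangle (h : IsMergingSequence ap am b c d α β a₀ b₀ c₀ d₀) :
    Tendsto (fun n => triTriangle (ap n) (am n) (b n) (c n) (d n)) atTop
      (𝓝 (triTriangle a₀ a₀ b₀ c₀ d₀)) :=
  EdgeTriangle.tendsto_triTriangle h.tendsto_ap h.tendsto_am h.tendsto_b h.tendsto_c h.tendsto_d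

lemma tendsto_triEntropy (h : IsMergingSequence ap am b c d α β a₀ b₀ c₀ d₀) :
    Tendsto (fun n => triEntropy (ap n) (am n) (b n) (c n) (d n)) atTop
      (𝓝 (triEntropy a₀ a₀ b₀ c₀ d₀)) :=
  EdgeTriangle.tendsto_triEntropy h.tendsto_ap h.tendsto_am h.tendsto_b h.tendsto_c h.tendsto_d

lemma triEntropy_le (h : IsMergingSequence ap am b c d α β a₀ b₀ c₀ d₀) {ap' am' b' c' d' : ℝ}
    (hap : ap' ∈ Set.Icc (0 : ℝ) 1) (ham : am' ∈ Set.Icc (0 : ℝ) 1)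
    (hb : b' ∈ Set.Icc (0 : ℝ) 1) (hc : c' ∈ Set.Icc (0 : ℝ) 1) (hd : d' ∈ Set.Icc (0 : ℝ) 1)
    (hedge : triEdge ap' am' b' c' d' = triEdge a₀ a₀ b₀ c₀ d₀)
    (htriangle : triTriangle ap' am' b' c' d' < triTriangle a₀ a₀ b₀ c₀ d₀) :
    triEntropy ap' am' b' c' d' ≤ triEntropy a₀ a₀ b₀ c₀ d₀ := by
  by_contra! hentropy
  set e := triEdge a₀ a₀ b₀ c₀ d₀
  let E (n : ℕ) : ℝ := triEdge (ap n) (am n) (b n) (c n) (d n)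
  have hE : Tendsto E atTop (𝓝 e) := h.tendsto_triEdge
  obtain ⟨s, hs, hmem⟩ := exists_tendsto_one_of_tendsto h.limit.triEdge_mem_Ioo h.triEdge_mem hE
  let move (u : ℝ) (n : ℕ) : ℝ := E n + s n * (u - e)
  have hmove u : Tendsto (move u) atTop (𝓝 u) := by
    simpa using hE.add (hs.mul_const (u - e))
  have hfewer := (EdgeTriangle.tendsto_triTriangle (hmove ap') (hmove am') (hmove b')
    (tendsto_const_nhds (x := c')) (hmove d')).eventually_lt h.tendsto_triTriangle htriangle
  have hmore := h.tendsto_triEntropy.eventually_lt (EdgeTriangle.tendsto_triEntropy (hmove ap')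
    (hmove am') (hmove b') (tendsto_const_nhds (x := c')) (hmove d')) hentropy
  obtain ⟨n, hn_fewer, hn_more⟩ := (hfewer.and hmore).exists
  have hn_edge : triEdge (move ap' n) (move am' n) (move b' n) c' (move d' n) = E n := by
    rw [triEdge_const_add_mul_sub, hedge, sub_self, mul_zero, add_zero]
  exact hn_more.not_ge (h.maximal n _ _ _ _ _ (hmem n _ hap) (hmem n _ ham) (hmem n _ hb) hc
    (hmem n _ hd) hn_edge hn_fewer.le)

lemma binEntropy_le (h : IsMergingSequence ap am b c d α β a₀ b₀ c₀ d₀)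
    (hlt : triEdge a₀ a₀ b₀ c₀ d₀ < 1 / 2) :
    Real.binEntropy (2 * triEdge a₀ a₀ b₀ c₀ d₀) / 4 ≤ triEntropy a₀ a₀ b₀ c₀ d₀ := by
  have hE := h.tendsto_triEdge
  refine le_of_tendsto_of_tendsto
    (((Real.binEntropy_continuous.tendsto _).comp (hE.const_mul 2)).div_const 4)
    h.tendsto_triEntropy ?_
  filter_upwards [hE.eventually (gt_mem_nhds hlt)] with n hn
  have hzero : (0 : ℝ) ∈ Set.Icc (0 : ℝ) 1 := by simp
  set E := triEdge (ap n) (am n) (b n) (c n) (d n)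
  have hedge : triEdge 0 0 0 (1 / 2) (2 * E) = E := by
    rw [triEdge_eq]
    ring
  have htriangle : triTriangle 0 0 0 (1 / 2) (2 * E) = 0 := by
    rw [triTriangle_eq]
    ring
  have hentropy : triEntropy 0 0 0 (1 / 2) (2 * E) = Real.binEntropy (2 * E) / 4 := by
    rw [triEntropy_eq, Real.binEntropy_zero]
    ring
  have hmax := h.maximal n 0 0 0 (1 / 2) (2 * E) hzero hzero hzero
    ⟨by norm_num, by norm_num⟩ ⟨by linarith [(h.triEdge_mem n).1], by linarith⟩ hedge
    (htriangle.trans_le (triTriangle_nonneg (h.ap_mem n).1.le (h.am_mem n).1.le (h.b_mem n).1.le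
      (Set.Ioo_subset_Icc_self (h.c_mem n))))
  rwa [hentropy] at hmax

lemma isCriticalBipodal (h : IsMergingSequence ap am b c d α β a₀ b₀ c₀ d₀) :
    IsCriticalBipodal a₀ b₀ c₀ d₀ := by
  have hβ := h.tendsto_multiplier
  have hsize := tendsto_podeSize h.tendsto_c
  have hvalue := tendsto_podeValue h.tendsto_ap h.tendsto_am h.tendsto_b h.tendsto_d
  refine ⟨h.limit, fun i j k l hlt => ?_, fun i j hmem => ?_,
    fun _ _ _ _ _ => h.triEntropy_le, h.binEntropy_le⟩
  · obtain ⟨i, rfl⟩ := merge_surjective i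
    obtain ⟨j, rfl⟩ := merge_surjective j
    obtain ⟨k, rfl⟩ := merge_surjective k
    obtain ⟨l, rfl⟩ := merge_surjective l
    simp only [← codegree_podeValue, ← podeValue_merge] at hlt ⊢
    exact IsCriticalStep.eq_zero_or_eq_one_of_codegree_lt h.critical hβ hsize hvalue hlt
  · obtain ⟨i, rfl⟩ := merge_surjective i
    obtain ⟨j, rfl⟩ := merge_surjective j
    simp only [← blockSum_podeSize, ← codegree_podeValue, ← podeValue_merge] at hmem ⊢
    exact IsCriticalStep.blockSum_mul_codegree_eq h.critical hβ hsize hvalue hmem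

end IsMergingSequence

/-! ### Splitting a pode -/

lemma add_mul_log_add_le {a t : ℝ} (h : |t| < a) :
    (a + t) * Real.log (a + t) ≤ (a + t) * Real.log a + (a + t) * t / a := by
  have ha : 0 < a := (abs_nonneg t).trans_lt h
  have hat : 0 < a + t := by linarith [neg_abs_le t]
  have hlog := Real.log_le_sub_one_of_pos (div_pos hat ha)
  rw [Real.log_div hat.ne' ha.ne', div_sub_one ha.ne', add_sub_cancel_left] at hlog
  calc (a + t) * Real.log (a + t) ≤ (a + t) * (Real.log a + t / a) := by gcongr; linarith
    _ = (a + t) * Real.log a + (a + t) * t / a := by ring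

lemma two_mul_binEntropy_sub_le {a t : ℝ} (h₀ : |t| < a) (h₁ : |t| < 1 - a) :
    2 * Real.binEntropy a - 2 * t ^ 2 / (a * (1 - a)) ≤
      Real.binEntropy (a + t) + Real.binEntropy (a - t) := by
  have ha₀ : 0 < a := (abs_nonneg t).trans_lt h₀
  have ha₁ : 0 < 1 - a := (abs_nonneg t).trans_lt h₁
  have hsum : 2 * t ^ 2 / (a * (1 - a)) = (a + t) * t / a + (a + -t) * -t / a +
      ((1 - a + t) * t / (1 - a) + (1 - a + -t) * -t / (1 - a)) := by
    field_simp
    ring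
  have hadd : 1 - (a + t) = 1 - a + -t := by ring
  have hsub : 1 - (a + -t) = 1 - a + t := by ring
  simp only [Real.binEntropy, Real.log_inv, hsum, sub_eq_add_neg a t, hadd, hsub]
  linarith [add_mul_log_add_le h₀, add_mul_log_add_le (t := -t) (by simpa using h₀),
    add_mul_log_add_le h₁, add_mul_log_add_le (t := -t) (by simpa using h₁)]

lemma triEdge_add_sub (a b c d t : ℝ) : triEdge (a + t) (a - t) b c d = triEdge a a b c d := by
  simp only [triEdge_eq]
  ring

lemma triTriangle_add_sub (a b c d t : ℝ) :
    triTriangle (a + t) (a - t) b c d = triTriangle a a b c d - c ^ 3 * t ^ 3 := by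
  simp only [triTriangle_eq]
  ring

lemma triEntropy_sub_le_triEntropy_add_sub {a b c d t : ℝ} (hc : c ∈ Set.Icc (0 : ℝ) 1)
    (h₀ : |t| < a) (h₁ : |t| < 1 - a) :
    triEntropy a a b c d - t ^ 2 / (a * (1 - a)) ≤ triEntropy (a + t) (a - t) b c d := by
  have ha₀ : 0 < a := (abs_nonneg t).trans_lt h₀
  have ha₁ : 0 < 1 - a := (abs_nonneg t).trans_lt h₁
  have hloss : c ^ 2 / 4 * (2 * t ^ 2 / (a * (1 - a))) ≤ t ^ 2 / (a * (1 - a)) := by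
    rw [mul_div_assoc, ← mul_assoc]
    exact mul_le_of_le_one_left (by positivity) (by linarith [pow_le_one₀ (n := 2) hc.1 hc.2])
  have hsplit := mul_le_mul_of_nonneg_left (two_mul_binEntropy_sub_le h₀ h₁)
    (by positivity : 0 ≤ c ^ 2 / 4)
  simp only [triEntropy_eq]
  linarith

lemma IsCriticalBipodal.triEntropy_le_of_split {a₀ b₀ c₀ d₀ a b c d t : ℝ}
    (h : IsCriticalBipodal a₀ b₀ c₀ d₀) (hb : b ∈ Set.Icc (0 : ℝ) 1) (hc : c ∈ Set.Icc (0 : ℝ) 1)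
    (hd : d ∈ Set.Icc (0 : ℝ) 1) (ht₀ : |t| < a) (ht₁ : |t| < 1 - a)
    (hedge : triEdge a a b c d = triEdge a₀ a₀ b₀ c₀ d₀)
    (htriangle : triTriangle a a b c d - c ^ 3 * t ^ 3 < triTriangle a₀ a₀ b₀ c₀ d₀) :
    triEntropy a a b c d - t ^ 2 / (a * (1 - a)) ≤ triEntropy a₀ a₀ b₀ c₀ d₀ := by
  obtain ⟨hlo, hhi⟩ := abs_le.1 (le_refl |t|)
  exact (triEntropy_sub_le_triEntropy_add_sub hc ht₀ ht₁).trans <|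
    h.maximal _ _ _ _ _ ⟨by linarith, by linarith⟩ ⟨by linarith, by linarith⟩ hb hc hd
      ((triEdge_add_sub ..).trans hedge) ((triTriangle_add_sub ..).trans_lt htriangle)

lemma exists_eventually_abs_sub_le_mul_sq {f : ℝ → ℝ} (hf : ContDiffAt ℝ 2 f 0)
    (hf' : HasDerivAt f 0 0) :
    ∃ K : ℝ, 0 ≤ K ∧ ∀ᶠ y in 𝓝 (0 : ℝ), |f y - f 0| ≤ K * y ^ 2 := by
  have hdiff : DifferentiableAt ℝ (fderiv ℝ f) 0 :=
    (hf.fderiv_right (m := 1) (by norm_num)).differentiableAt (by norm_num)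
  obtain ⟨C, hC⟩ := hdiff.isBigO_sub.bound
  have hdiff' : ∀ᶠ y in 𝓝 (0 : ℝ), DifferentiableAt ℝ f y :=
    (hf.eventually (by simp)).mono fun y hy => hy.differentiableAt (by norm_num)
  have hzero : fderiv ℝ f 0 = 0 := by
    ext
    simpa using hf'.deriv
  obtain ⟨r, hr, hball⟩ := Metric.eventually_nhds_iff_ball.1 (hC.and hdiff')
  refine ⟨|C|, abs_nonneg C, ?_⟩
  filter_upwards [Metric.ball_mem_nhds (0 : ℝ) hr] with y hy
  have hsub : Metric.closedBall (0 : ℝ) |y| ⊆ Metric.ball 0 r :=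
    Metric.closedBall_subset_ball (by simpa using hy)
  have hfderiv : ∀ x ∈ Metric.closedBall (0 : ℝ) |y|, ‖fderiv ℝ f x‖ ≤ |C| * |y| := by
    intro x hx
    have hle := (hball x (hsub hx)).1
    rw [hzero, sub_zero, sub_zero] at hle
    exact hle.trans (mul_le_mul (le_abs_self C) (by simpa using hx) (norm_nonneg _)
      (abs_nonneg C))
  have hmvt := (convex_closedBall (0 : ℝ) |y|).norm_image_sub_le_of_norm_fderiv_le (𝕜 := ℝ)
    (fun x hx => (hball x (hsub hx)).2) hfderiv (x := 0) (y := y) (by simp) (by simp)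
  simpa only [Real.norm_eq_abs, sub_zero, mul_assoc, abs_mul_abs_self, ← sq, sq_abs] using hmvt

/-- A path of bipodal graphons of constant edge density, with its basepoint at the parameter `0`,
where the triangle density is stationary. -/
structure IsTriangleStationaryPath (a b c d : ℝ → ℝ) : Prop where
  contDiffAt_a : ContDiffAt ℝ 2 a 0
  contDiffAt_b : ContDiffAt ℝ 2 b 0
  contDiffAt_c : ContDiffAt ℝ 2 c 0
  contDiffAt_d : ContDiffAt ℝ 2 d 0
  b_mem : ∀ᶠ y in 𝓝 0, b y ∈ Set.Icc (0 : ℝ) 1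
  d_mem : ∀ᶠ y in 𝓝 0, d y ∈ Set.Icc (0 : ℝ) 1
  edge : ∀ᶠ y in 𝓝 0, triEdge (a y) (a y) (b y) (c y) (d y) =
    triEdge (a 0) (a 0) (b 0) (c 0) (d 0)
  triangle : HasDerivAt (fun y => triTriangle (a y) (a y) (b y) (c y) (d y)) 0 0

section

variable {a b c d : ℝ → ℝ}

lemma IsTriangleStationaryPath.exists_eventually_triTriangle_le
    (hpath : IsTriangleStationaryPath a b c d) : ∃ K : ℝ, 0 ≤ K ∧ ∀ᶠ y in 𝓝 (0 : ℝ),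
      triTriangle (a y) (a y) (b y) (c y) (d y) ≤
        triTriangle (a 0) (a 0) (b 0) (c 0) (d 0) + K * y ^ 2 := by
  obtain ⟨ha, hb, hc, hd, -, -, -, ht⟩ := hpath
  have hcontDiff : ContDiffAt ℝ 2 (fun y => triTriangle (a y) (a y) (b y) (c y) (d y)) 0 := by
    simp only [triTriangle_eq]
    fun_prop
  obtain ⟨K, hK₀, hK⟩ := exists_eventually_abs_sub_le_mul_sq hcontDiff ht
  exact ⟨K, hK₀, hK.mono fun y hy => by linarith [(abs_le.1 hy).2]⟩

/- Splitting by `t = M |y| ^ (2/3)` destroys `c³ t³ = M³ c³ y²` triangles, for large `M` more than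
the `O(y²)` that the path creates, at an entropy cost of `O(|y| ^ (4/3))`. -/
lemma IsCriticalBipodal.exists_eventually_triEntropy_sub_le
    (h : IsCriticalBipodal (a 0) (b 0) (c 0) (d 0)) (ha₀ : a 0 ∈ Set.Ioo (0 : ℝ) 1)
    (hpath : IsTriangleStationaryPath a b c d) : ∃ M : ℝ, ∀ᶠ y in 𝓝 (0 : ℝ),
      triEntropy (a y) (a y) (b y) (c y) (d y) - M * |y| ^ (4 / 3 : ℝ) / (a y * (1 - a y)) ≤
        triEntropy (a 0) (a 0) (b 0) (c 0) (d 0) := by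
  obtain ⟨K, hK₀, hK⟩ := hpath.exists_eventually_triTriangle_le
  have hc₀ := h.isB11.c_mem
  set M := 2 * (K + 1) / c 0 with hM
  set t : ℝ → ℝ := fun y => M * |y| ^ (2 / 3 : ℝ) with ht
  have ht_sq (y : ℝ) : t y ^ 2 = M ^ 2 * |y| ^ (4 / 3 : ℝ) := by
    rw [ht, mul_pow, ← Real.rpow_mul_natCast (abs_nonneg y)]
    norm_num
  have ht_cube (y : ℝ) : t y ^ 3 = M ^ 3 * y ^ 2 := by
    rw [ht, mul_pow, ← Real.rpow_mul_natCast (abs_nonneg y), ← sq_abs y]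
    norm_num
  have ht_tendsto : Tendsto (fun y => |t y|) (𝓝 0) (𝓝 0) :=
    Continuous.tendsto' (by fun_prop (disch := norm_num)) _ _ (by simp [ht])
  have ha := hpath.contDiffAt_a.continuousAt
  refine ⟨M ^ 2, ?_⟩
  filter_upwards [hK, hpath.b_mem, hpath.d_mem, hpath.edge, ht_tendsto.eventually_lt ha ha₀.1,
    ht_tendsto.eventually_lt (ha.const_sub 1) (sub_pos.2 ha₀.2),
    hpath.contDiffAt_c.continuousAt.eventually (isOpen_Ioo.mem_nhds ⟨half_lt_self hc₀.1, hc₀.2⟩)]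
    with y htriangle hb hd hedge ht₀ ht₁ hc
  have hcy : 0 < c y := (half_pos hc₀.1).trans hc.1
  rcases eq_or_ne y 0 with rfl | hy
  · simp
  have hgain : K < c y ^ 3 * M ^ 3 := by
    have hone : K + 1 ≤ c y * M := by
      rw [hM, mul_div_assoc', le_div_iff₀ hc₀.1]
      nlinarith [hc.1]
    rw [← mul_pow]
    nlinarith [le_self_pow₀ (by linarith : 1 ≤ c y * M) three_ne_zero]
  rw [← ht_sq]
  refine h.triEntropy_le_of_split hb ⟨hcy.le, hc.2.le⟩ hd ht₀ ht₁ hedge ?_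
  rw [ht_cube, ← mul_assoc]
  linarith [mul_lt_mul_of_pos_right hgain (sq_pos_of_ne_zero hy)]

lemma IsCriticalBipodal.eq_zero_of_hasDerivAt
    (h : IsCriticalBipodal (a 0) (b 0) (c 0) (d 0)) (ha₀ : a 0 ∈ Set.Ioo (0 : ℝ) 1)
    (hpath : IsTriangleStationaryPath a b c d) {r : ℝ}
    (hentropy : HasDerivAt (fun y => triEntropy (a y) (a y) (b y) (c y) (d y)) r 0) : r = 0 := by
  obtain ⟨M, hM⟩ := h.exists_eventually_triEntropy_sub_le ha₀ hpath
  have ha := (hpath.contDiffAt_a.differentiableAt two_ne_zero).hasDerivAt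
  have hloss : HasDerivAt (fun y => M * |y| ^ (4 / 3 : ℝ) / (a y * (1 - a y))) 0 0 := by
    have hpow := (hasDerivAt_abs_rpow 0 (by norm_num : 1 < (4 / 3 : ℝ))).const_mul M
    refine (hpow.div (ha.mul (ha.const_sub 1))
      (mul_pos ha₀.1 (sub_pos.2 ha₀.2)).ne').congr_deriv ?_
    simp
  have hmax : IsLocalMax (fun y => triEntropy (a y) (a y) (b y) (c y) (d y) -
      M * |y| ^ (4 / 3 : ℝ) / (a y * (1 - a y))) 0 :=
    hM.mono fun y hy => by simpa using hy
  simpa using hmax.hasDerivAt_eq_zero (hentropy.sub hloss)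

end

/-! ### First-order conditions at a critical bipodal graphon -/

lemma triTriangle_self (a b c d : ℝ) :
    triTriangle a a b c d = stepTriangle (bipodeSize c) (bipodeValue a b d) := by
  simp only [triTriangle_eq, stepTriangle, bipodeSize, bipodeValue, Fin.sum_univ_two,
    Matrix.cons_val]
  ring

lemma triEntropy_self (a b c d : ℝ) :
    triEntropy a a b c d = blockSum (bipodeSize c) (bipodeSize c)
      (fun i j => Real.binEntropy (bipodeValue a b d i j)) / 2 := by
  simp only [triEntropy_eq, blockSum, bipodeSize, bipodeValue, Fin.sum_univ_two, Matrix.cons_val]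
  ring

lemma bipodeValue_symm (a b d : ℝ) (i j : Fin 2) :
    bipodeValue a b d i j = bipodeValue a b d j i := by
  fin_cases i <;> fin_cases j <;> rfl

section

variable {u u' : ℝ}

lemma hasDerivAt_const_add_mul (u u' : ℝ) : HasDerivAt (fun y : ℝ => u + y * u') u' 0 := by
  simpa using ((hasDerivAt_id (0 : ℝ)).mul_const u').const_add u

lemma eventually_const_add_mul_mem_Icc (hu : u ∈ Set.Icc (0 : ℝ) 1)
    (hu' : u ∈ Set.Ioo (0 : ℝ) 1 ∨ u' = 0) : ∀ᶠ y : ℝ in 𝓝 0, u + y * u' ∈ Set.Icc (0 : ℝ) 1 := by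
  rcases hu' with hu' | rfl
  · have htendsto : Tendsto (fun y : ℝ => u + y * u') (𝓝 0) (𝓝 u) :=
      Continuous.tendsto' (by fun_prop) _ _ (by simp)
    exact htendsto.eventually (Icc_mem_nhds hu'.1 hu'.2)
  · simp [hu.1, hu.2]

lemma hasDerivAt_binEntropy_comp {f : ℝ → ℝ} (hf : HasDerivAt f u' 0)
    (hu : f 0 ∈ Set.Ioo (0 : ℝ) 1) :
    HasDerivAt (fun y => Real.binEntropy (f y)) (entropySlope (f 0) * u') 0 :=
  (hasDerivAt_binEntropy hu).comp 0 hf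

lemma hasDerivAt_binEntropy_const_add_mul (hu : u ∈ Set.Ioo (0 : ℝ) 1 ∨ u' = 0) :
    HasDerivAt (fun y : ℝ => Real.binEntropy (u + y * u')) (entropySlope u * u') 0 := by
  rcases hu with hu | rfl
  · simpa using hasDerivAt_binEntropy_comp (hasDerivAt_const_add_mul u u') (by simpa using hu)
  · simpa using hasDerivAt_const (0 : ℝ) (Real.binEntropy u)

end

lemma entropySlope_injOn : Set.InjOn entropySlope (Set.Ioo 0 1) := by
  intro x hx y hy hxy
  have hle := sq_sub_le_entropySlope_sub_mul hx hy
  rw [hxy, sub_self, zero_mul] at hle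
  exact sub_eq_zero.1 (pow_eq_zero_iff two_ne_zero |>.1 (hle.antisymm (sq_nonneg _)))

/-- The value on the first diagonal block that gives a bipodal graphon the edge density `e`. -/
def bipodeFill (e b c d : ℝ) : ℝ := (e - 2 * c * (1 - c) * d - (1 - c) ^ 2 * b) / c ^ 2

lemma triEdge_bipodeFill {c : ℝ} (hc : c ≠ 0) (e b d : ℝ) :
    triEdge (bipodeFill e b c d) (bipodeFill e b c d) b c d = e := by
  rw [triEdge_eq, bipodeFill]
  field_simp
  ring

lemma bipodeFill_triEdge {c : ℝ} (hc : c ≠ 0) (a b d : ℝ) :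
    bipodeFill (triEdge a a b c d) b c d = a := by
  rw [triEdge_eq, bipodeFill]
  field_simp
  ring

section

variable {a b c d a' b' c' d' : ℝ}

lemma hasDerivAt_bipodeFill (hc : c ≠ 0)
    (hedge : 2 * blockSum ![c', -c'] (bipodeSize c) (bipodeValue a b d) +
      blockSum (bipodeSize c) (bipodeSize c) (bipodeValue a' b' d') = 0) :
    HasDerivAt (fun y => bipodeFill (triEdge a a b c d) (b + y * b') (c + y * c') (d + y * d'))
      a' 0 := by
  have hb := hasDerivAt_const_add_mul b b'
  have hc' := hasDerivAt_const_add_mul c c'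
  have hd := hasDerivAt_const_add_mul d d'
  refine (((((hc'.const_mul 2).mul (hc'.const_sub 1)).mul hd).const_sub
    (triEdge a a b c d)).sub (((hc'.const_sub 1).pow 2).mul hb)).div (hc'.pow 2)
    (by simpa using hc) |>.congr_deriv ?_
  simp only [blockSum, bipodeSize, bipodeValue, Fin.sum_univ_two, Matrix.cons_val] at hedge
  simp only [triEdge_eq, Pi.mul_apply, Pi.pow_apply, Pi.sub_apply, zero_mul, add_zero]
  field_simp
  linear_combination (-2 * c ^ 2) * hedge

lemma hasDerivAt_bipodeSize (c c' : ℝ) (i : Fin 2) :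
    HasDerivAt (fun y => bipodeSize (c + y * c') i) ((![c', -c'] : Fin 2 → ℝ) i) 0 := by
  fin_cases i
  exacts [hasDerivAt_const_add_mul c c', (hasDerivAt_const_add_mul c c').const_sub 1]

lemma hasDerivAt_bipodeValue {A B D : ℝ → ℝ} (hA : HasDerivAt A a' 0) (hB : HasDerivAt B b' 0)
    (hD : HasDerivAt D d' 0) (i j : Fin 2) : HasDerivAt (fun y => bipodeValue (A y) (B y) (D y) i j)
      (bipodeValue a' b' d' i j) 0 := by
  fin_cases i <;> fin_cases j
  exacts [hA, hD, hD, hB]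

lemma isTriangleStationaryPath_bipodeFill (hb : b ∈ Set.Icc (0 : ℝ) 1)
    (hb' : b ∈ Set.Ioo (0 : ℝ) 1 ∨ b' = 0) (hc : c ≠ 0) (hd : d ∈ Set.Icc (0 : ℝ) 1)
    (hd' : d ∈ Set.Ioo (0 : ℝ) 1 ∨ d' = 0)
    (hedge : 2 * blockSum ![c', -c'] (bipodeSize c) (bipodeValue a b d) +
      blockSum (bipodeSize c) (bipodeSize c) (bipodeValue a' b' d') = 0)
    (htriangle : blockSum ![c', -c'] (bipodeSize c) (fun i j =>
        bipodeValue a b d i j * codegree (bipodeSize c) (bipodeValue a b d) i j) +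
      blockSum (bipodeSize c) (bipodeSize c) (fun i j =>
        bipodeValue a' b' d' i j * codegree (bipodeSize c) (bipodeValue a b d) i j) = 0) :
    IsTriangleStationaryPath
      (fun y => bipodeFill (triEdge a a b c d) (b + y * b') (c + y * c') (d + y * d'))
      (fun y => b + y * b') (fun y => c + y * c') (fun y => d + y * d') where
  contDiffAt_a := by
    unfold bipodeFill
    exact ContDiffAt.div (by fun_prop) (by fun_prop) (by simpa using hc)
  contDiffAt_b := by fun_prop
  contDiffAt_c := by fun_prop
  contDiffAt_d := by fun_prop
  b_mem := eventually_const_add_mul_mem_Icc hb hb'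
  d_mem := eventually_const_add_mul_mem_Icc hd hd'
  edge := by
    have hne : ∀ᶠ y : ℝ in 𝓝 0, c + y * c' ≠ 0 :=
      ContinuousAt.eventually_ne (by fun_prop) (by simpa using hc)
    filter_upwards [hne] with y hy
    rw [triEdge_bipodeFill hy, triEdge_bipodeFill (by simpa using hc)]
  triangle := by
    simp only [triTriangle_self]
    have hvalue := hasDerivAt_bipodeValue (hasDerivAt_bipodeFill hc hedge)
      (hasDerivAt_const_add_mul b b') (hasDerivAt_const_add_mul d d')
    refine (hasDerivAt_stepTriangle (hasDerivAt_bipodeSize c c') hvalue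
      (bipodeValue_symm _ _ _)).congr_deriv ?_
    simp only [zero_mul, add_zero, bipodeFill_triEdge hc, htriangle, mul_zero]

lemma IsCriticalBipodal.entropy_stationary (h : IsCriticalBipodal a b c d)
    (ha : a ∈ Set.Ioo (0 : ℝ) 1) (hb : b ∈ Set.Ioo (0 : ℝ) 1 ∨ b' = 0)
    (hd : d ∈ Set.Ioo (0 : ℝ) 1 ∨ d' = 0)
    (hedge : 2 * blockSum ![c', -c'] (bipodeSize c) (bipodeValue a b d) +
      blockSum (bipodeSize c) (bipodeSize c) (bipodeValue a' b' d') = 0)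
    (htriangle : blockSum ![c', -c'] (bipodeSize c) (fun i j =>
        bipodeValue a b d i j * codegree (bipodeSize c) (bipodeValue a b d) i j) +
      blockSum (bipodeSize c) (bipodeSize c) (fun i j =>
        bipodeValue a' b' d' i j * codegree (bipodeSize c) (bipodeValue a b d) i j) = 0) :
    2 * blockSum ![c', -c'] (bipodeSize c)
        (fun i j => Real.binEntropy (bipodeValue a b d i j)) +
      blockSum (bipodeSize c) (bipodeSize c)
        (fun i j => entropySlope (bipodeValue a b d i j) * bipodeValue a' b' d' i j) = 0 := by
  have hc : c ≠ 0 := h.isB11.c_mem.1.ne'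
  have hpath := isTriangleStationaryPath_bipodeFill h.isB11.b_mem hb hc h.isB11.d_mem hd hedge
    htriangle
  have hA := hasDerivAt_bipodeFill hc hedge
  have hA₀ : (fun y => bipodeFill (triEdge a a b c d) (b + y * b') (c + y * c') (d + y * d')) 0 =
      a := by
    simp only [zero_mul, add_zero, bipodeFill_triEdge hc]
  generalize (fun y => bipodeFill (triEdge a a b c d) (b + y * b') (c + y * c') (d + y * d')) = A
    at hpath hA hA₀
  have hvalue (i j : Fin 2) : HasDerivAt
      (fun y => Real.binEntropy (bipodeValue (A y) (b + y * b') (d + y * d') i j))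
      (entropySlope (bipodeValue a b d i j) * bipodeValue a' b' d' i j) 0 := by
    fin_cases i <;> fin_cases j
    exacts [hA₀ ▸ hasDerivAt_binEntropy_comp hA (hA₀ ▸ ha), hasDerivAt_binEntropy_const_add_mul hd,
      hasDerivAt_binEntropy_const_add_mul hd, hasDerivAt_binEntropy_const_add_mul hb]
  have hentropy := (hasDerivAt_blockSum (hasDerivAt_bipodeSize c c') hvalue
    fun i j => congrArg Real.binEntropy (bipodeValue_symm _ _ _ i j)).div_const 2
  simp only [← triEntropy_self] at hentropy
  have hzero := IsCriticalBipodal.eq_zero_of_hasDerivAt (by simpa [hA₀] using h)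
    (hA₀.symm ▸ ha) hpath hentropy
  simpa [hA₀] using hzero

end

/-! ### There is no critical bipodal graphon -/

section

variable (a b c d : ℝ)

lemma codegree_bipodeValue_zero_zero :
    codegree (bipodeSize c) (bipodeValue a b d) 0 0 = c * a ^ 2 + (1 - c) * d ^ 2 := by
  simp only [codegree, bipodeSize, bipodeValue, Fin.sum_univ_two, Matrix.cons_val]
  ring

lemma codegree_bipodeValue_zero_one :
    codegree (bipodeSize c) (bipodeValue a b d) 0 1 = c * a * d + (1 - c) * d * b := by
  simp only [codegree, bipodeSize, bipodeValue, Fin.sum_univ_two, Matrix.cons_val]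
  ring

lemma codegree_bipodeValue_one_one :
    codegree (bipodeSize c) (bipodeValue a b d) 1 1 = c * d ^ 2 + (1 - c) * b ^ 2 := by
  simp only [codegree, bipodeSize, bipodeValue, Fin.sum_univ_two, Matrix.cons_val]
  ring

end

variable {a b c d : ℝ}

lemma IsCriticalBipodal.codegree_le (h : IsCriticalBipodal a b c d) {i j k l : Fin 2}
    (hij : bipodeValue a b d i j ≠ 0) (hkl : bipodeValue a b d k l ≠ 1) :
    codegree (bipodeSize c) (bipodeValue a b d) i j ≤
      codegree (bipodeSize c) (bipodeValue a b d) k l :=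
  not_lt.1 fun hlt => (h.eq_zero_or_eq_one _ _ _ _ hlt).elim hij hkl

lemma IsCriticalBipodal.codegree_eq (h : IsCriticalBipodal a b c d) {i j k l : Fin 2}
    (hij : bipodeValue a b d i j ∈ Set.Ioo (0 : ℝ) 1)
    (hkl : bipodeValue a b d k l ∈ Set.Ioo (0 : ℝ) 1) :
    codegree (bipodeSize c) (bipodeValue a b d) i j =
      codegree (bipodeSize c) (bipodeValue a b d) k l :=
  (h.codegree_le hij.1.ne' hkl.2.ne).antisymm (h.codegree_le hkl.1.ne' hij.2.ne)

lemma not_isCriticalBipodal_zero_zero : ¬ IsCriticalBipodal 0 0 c d := by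
  intro h
  have hc := h.isB11.c_mem
  have hd := h.isB11.d_mem
  have hd₀ : 0 ≠ d := fun hd₀ => h.isB11.not_constant ⟨hd₀, hd₀⟩
  have hhalf : c ≠ 1 / 2 := fun hc' => h.isB11.not_A20 ⟨rfl, hc'⟩
  have hpos : 0 < 4 * c * (1 - c) := by nlinarith [hc.1, hc.2]
  have hlt : 0 < 1 - 4 * c * (1 - c) := by
    nlinarith [sq_pos_of_ne_zero (sub_ne_zero.2 hhalf)]
  have hedge : 2 * triEdge 0 0 0 c d = 4 * c * (1 - c) * d := by rw [triEdge_eq]; ring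
  have hbipartite := h.bipartite (by nlinarith [hd.2])
  have hconcave := Real.strictConcave_binEntropy.2 (Set.left_mem_Icc.2 zero_le_one) hd hd₀ hlt hpos
    (sub_add_cancel _ _)
  simp only [smul_eq_mul, mul_zero, zero_add, Real.binEntropy_zero] at hconcave
  rw [hedge, triEntropy_eq, Real.binEntropy_zero] at hbipartite
  linarith

lemma not_isCriticalBipodal_off_diagonal_one (ha : a ∈ Set.Ioo (0 : ℝ) 1)
    (hb : b ∈ Set.Ioo (0 : ℝ) 1) : ¬ IsCriticalBipodal a b c 1 := by
  intro h
  have hc := h.isB11.c_mem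
  have hcodegree := h.codegree_eq (i := 0) (j := 0) (k := 1) (l := 1) ha hb
  have hstationary := h.entropy_stationary (a' := (1 - c) ^ 2) (b' := -c ^ 2) (c' := 0) (d' := 0)
    ha (.inl hb) (.inr rfl)
    (by
      simp only [blockSum, bipodeSize, bipodeValue, Fin.sum_univ_two, Matrix.cons_val]
      ring)
    (by
      simp only [blockSum, codegree, bipodeSize, bipodeValue, Fin.sum_univ_two,
        Matrix.cons_val] at hcodegree ⊢
      linear_combination (c * (1 - c)) ^ 2 * hcodegree)
  have hslope : (c * (1 - c)) ^ 2 * (entropySlope a - entropySlope b) = 0 := by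
    rw [← hstationary]
    simp only [blockSum, bipodeSize, bipodeValue, Fin.sum_univ_two, Matrix.cons_val]
    ring
  have hab : a = b := entropySlope_injOn ha hb <| sub_eq_zero.1 <|
    (mul_eq_zero.1 hslope).resolve_left (pow_pos (mul_pos hc.1 (sub_pos.2 hc.2)) 2).ne'
  subst hab
  rw [codegree_bipodeValue_zero_zero, codegree_bipodeValue_one_one] at hcodegree
  have hbalance : (2 * c - 1) * (1 - a ^ 2) = 0 := by linear_combination -hcodegree
  rcases mul_eq_zero.1 hbalance with hhalf | hone
  · exact h.isB11.not_A20 ⟨rfl, by linarith⟩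
  · nlinarith [ha.1, ha.2]

lemma not_isCriticalBipodal_second_zero (ha : a ∈ Set.Ioo (0 : ℝ) 1)
    (hd : d ∈ Set.Ioo (0 : ℝ) 1) : ¬ IsCriticalBipodal a 0 c d := by
  intro h
  have hc := h.isB11.c_mem
  have hc₁ : 0 < 1 - c := sub_pos.2 hc.2
  have hcodegree := h.codegree_eq (i := 0) (j := 0) (k := 0) (l := 1) ha hd
  have hstationary := h.entropy_stationary (a' := 2 * (1 - c)) (b' := 0) (c' := 0) (d' := -c)
    ha (.inr rfl) (.inl hd)
    (by
      simp only [blockSum, bipodeSize, bipodeValue, Fin.sum_univ_two, Matrix.cons_val]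
      ring)
    (by
      simp only [blockSum, codegree, bipodeSize, bipodeValue, Fin.sum_univ_two,
        Matrix.cons_val] at hcodegree ⊢
      linear_combination 2 * c ^ 2 * (1 - c) * hcodegree)
  have hslope : 2 * c ^ 2 * (1 - c) * (entropySlope a - entropySlope d) = 0 := by
    rw [← hstationary]
    simp only [blockSum, bipodeSize, bipodeValue, Fin.sum_univ_two, Matrix.cons_val]
    ring
  have had : a = d := entropySlope_injOn ha hd <| sub_eq_zero.1 <|
    (mul_eq_zero.1 hslope).resolve_left (mul_pos (mul_pos two_pos (pow_pos hc.1 2)) hc₁).ne'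
  subst had
  rw [codegree_bipodeValue_zero_zero, codegree_bipodeValue_zero_one] at hcodegree
  exact (mul_pos hc₁ (pow_pos ha.1 2)).ne' (by linear_combination hcodegree)

lemma not_isCriticalBipodal_second_zero_off_diagonal_one (ha : a ∈ Set.Ioo (0 : ℝ) 1) :
    ¬ IsCriticalBipodal a 0 c 1 := by
  intro h
  have hc := h.isB11.c_mem
  have hc₁ : 0 < 1 - c := sub_pos.2 hc.2
  have hhalf : 1 - c < c := by
    have hle := h.codegree_le (i := 0) (j := 0) (k := 1) (l := 1) ha.1.ne' zero_ne_one
    rw [codegree_bipodeValue_zero_zero, codegree_bipodeValue_one_one] at hle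
    linarith [mul_pos hc.1 (pow_pos ha.1 2)]
  have hsize := h.size 0 0 ha
  have hstationary := h.entropy_stationary (a' := -2 * (c * a + 1 - 2 * c)) (b' := 0)
    (c' := c ^ 2) (d' := 0) ha (.inr rfl) (.inr rfl)
    (by
      simp only [blockSum, bipodeSize, bipodeValue, Fin.sum_univ_two, Matrix.cons_val]
      ring)
    (by
      simp only [blockSum, bipodeSize, bipodeValue, Fin.sum_univ_two, Matrix.cons_val] at hsize ⊢
      linear_combination c ^ 2 * hsize)
  have hsum : 2 * c ^ 2 *
      (c * Real.binEntropy a - (c * a + 1 - 2 * c) * entropySlope a) = 0 := by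
    rw [← hstationary]
    simp only [blockSum, bipodeSize, bipodeValue, Fin.sum_univ_two, Matrix.cons_val,
      Real.binEntropy_zero, Real.binEntropy_one]
    ring
  have hlog : (2 * c - 1) * -Real.log a + (1 - c) * -Real.log (1 - a) = 0 := by
    rw [← (mul_eq_zero.1 hsum).resolve_left (mul_pos two_pos (pow_pos hc.1 2)).ne',
      entropySlope, Real.binEntropy, Real.log_inv, Real.log_inv]
    ring
  have hlog_a := mul_pos (by linarith : 0 < 2 * c - 1) (neg_pos.2 (Real.log_neg ha.1 ha.2))
  have hlog_one_sub := mul_pos hc₁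
    (neg_pos.2 (Real.log_neg (sub_pos.2 ha.2) (sub_lt_self 1 ha.1)))
  linarith

lemma not_isCriticalBipodal_first_one (hd : d ∈ Set.Ioo (0 : ℝ) 1) :
    ¬ IsCriticalBipodal 1 b c d := by
  intro h
  have hc := h.isB11.c_mem
  have hc₁ : 0 < 1 - c := sub_pos.2 hc.2
  have hle₀ := h.codegree_le (i := 0) (j := 0) (k := 0) (l := 1) one_ne_zero hd.2.ne
  rw [codegree_bipodeValue_zero_zero, codegree_bipodeValue_zero_one] at hle₀
  have hgain : c * (1 - d) ≤ (1 - c) * d * (b - d) := by linarith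
  have hdb : d < b := by
    by_contra! hbd
    linarith [mul_pos hc.1 (sub_pos.2 hd.2),
      mul_nonneg (mul_pos hc₁ hd.1).le (sub_nonneg.2 hbd)]
  have hle₁ := h.codegree_le (i := 1) (j := 1) (k := 0) (l := 1) (hd.1.trans hdb).ne' hd.2.ne
  rw [codegree_bipodeValue_one_one, codegree_bipodeValue_zero_one] at hle₁
  have hchain : b * ((1 - c) * (b - d)) ≤ d ^ 2 * ((1 - c) * (b - d)) := by
    linarith [mul_le_mul_of_nonneg_left hgain hd.1.le]
  have hbd := le_of_mul_le_mul_right hchain (mul_pos hc₁ (sub_pos.2 hdb))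
  nlinarith [hd.1, hd.2]

lemma not_isCriticalBipodal_of_mem_Ioo (ha : a ∈ Set.Ioo (0 : ℝ) 1) (hb : b ∈ Set.Ioo (0 : ℝ) 1)
    (hd : d ∈ Set.Ioo (0 : ℝ) 1) : ¬ IsCriticalBipodal a b c d := by
  intro h
  have hc := h.isB11.c_mem
  have hc₁ : 0 < 1 - c := sub_pos.2 hc.2
  have hfirst := h.codegree_eq (i := 0) (j := 0) (k := 0) (l := 1) ha hd
  have hsecond := h.codegree_eq (i := 1) (j := 1) (k := 0) (l := 1) hb hd
  rw [codegree_bipodeValue_zero_one] at hfirst hsecond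
  rw [codegree_bipodeValue_zero_zero] at hfirst
  rw [codegree_bipodeValue_one_one] at hsecond
  have hbalance : c * a * (a - d) = (1 - c) * d * (b - d) := by linear_combination hfirst
  have had : a ≠ d := by
    rintro rfl
    have hzero : (1 - c) * a * (b - a) = 0 := by linear_combination -hbalance
    exact h.isB11.not_constant ⟨rfl, sub_eq_zero.1 <|
      (mul_eq_zero.1 hzero).resolve_left (mul_pos hc₁ ha.1).ne'⟩
  have hgeometric : a * b = d ^ 2 := by
    have hprod : c * (a - d) * (a * b - d ^ 2) = 0 := by
      linear_combination b * hfirst + d * hsecond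
    exact sub_eq_zero.1 <| (mul_eq_zero.1 hprod).resolve_left <|
      mul_ne_zero hc.1.ne' (sub_ne_zero.2 had)
  have hsame : 0 < (a - d) * (b - d) := by
    have hscaled : (1 - c) * d * ((a - d) * (b - d)) = c * a * (a - d) ^ 2 := by
      linear_combination -(a - d) * hbalance
    exact pos_of_mul_pos_right (hscaled ▸
      mul_pos (mul_pos hc.1 ha.1) (sq_pos_of_ne_zero (sub_ne_zero.2 had)))
      (mul_pos hc₁ hd.1).le
  have hmean : a + b < 2 * d := by nlinarith [hd.1]
  nlinarith [sq_nonneg (a - b), ha.1, hb.1]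

lemma not_isCriticalBipodal_off_diagonal_zero : ¬ IsCriticalBipodal a b c 0 := by
  intro h
  have hc := h.isB11.c_mem
  have ha : a = 0 := by
    by_contra ha
    have hle := h.codegree_le (i := 0) (j := 0) (k := 0) (l := 1) ha zero_ne_one
    rw [codegree_bipodeValue_zero_zero, codegree_bipodeValue_zero_one] at hle
    linarith [mul_pos hc.1 (sq_pos_of_ne_zero ha)]
  have hb : b = 0 := by
    by_contra hb
    have hle := h.codegree_le (i := 1) (j := 1) (k := 0) (l := 1) hb zero_ne_one
    rw [codegree_bipodeValue_one_one, codegree_bipodeValue_zero_one] at hle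
    linarith [mul_pos (sub_pos.2 hc.2) (sq_pos_of_ne_zero hb)]
  exact h.isB11.not_constant ⟨ha, hb⟩

lemma not_isCriticalBipodal_first_one_off_diagonal_one : ¬ IsCriticalBipodal 1 b c 1 := by
  intro h
  have hb₀ := h.isB11.b_mem.1
  have hb₁ : b ≠ 1 := fun hb => h.isB11.not_constant ⟨rfl, hb⟩
  have hle := h.codegree_le (i := 0) (j := 0) (k := 1) (l := 1) one_ne_zero hb₁
  rw [codegree_bipodeValue_zero_zero, codegree_bipodeValue_one_one] at hle
  have hb_sq : b ^ 2 < 1 := by nlinarith [h.isB11.b_mem.2.lt_of_ne hb₁]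
  nlinarith [h.isB11.c_mem.2]

lemma eq_zero_or_mem_Ioo_or_eq_one {x : ℝ} (hx : x ∈ Set.Icc (0 : ℝ) 1) :
    x = 0 ∨ x ∈ Set.Ioo (0 : ℝ) 1 ∨ x = 1 := by
  rcases hx.1.eq_or_lt with hx₀ | hx₀
  · exact .inl hx₀.symm
  · exact .inr (hx.2.lt_or_eq.imp_left fun hx₁ => ⟨hx₀, hx₁⟩)

theorem not_isCriticalBipodal : ¬ IsCriticalBipodal a b c d := by
  intro h
  have ha := eq_zero_or_mem_Ioo_or_eq_one h.isB11.a_mem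
  have hb := eq_zero_or_mem_Ioo_or_eq_one h.isB11.b_mem
  rcases eq_zero_or_mem_Ioo_or_eq_one h.isB11.d_mem with rfl | hd | rfl
  · exact not_isCriticalBipodal_off_diagonal_zero h
  · rcases ha with rfl | ha | rfl <;> rcases hb with rfl | hb | rfl
    exacts [not_isCriticalBipodal_zero_zero h, not_isCriticalBipodal_second_zero hb hd h.swap,
      not_isCriticalBipodal_first_one hd h.swap, not_isCriticalBipodal_second_zero ha hd h,
      not_isCriticalBipodal_of_mem_Ioo ha hb hd h, not_isCriticalBipodal_first_one hd h.swap,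
      not_isCriticalBipodal_first_one hd h, not_isCriticalBipodal_first_one hd h,
      not_isCriticalBipodal_first_one hd h]
  · rcases ha with rfl | ha | rfl <;> rcases hb with rfl | hb | rfl
    exacts [not_isCriticalBipodal_zero_zero h,
      not_isCriticalBipodal_second_zero_off_diagonal_one hb h.swap,
      not_isCriticalBipodal_first_one_off_diagonal_one h.swap,
      not_isCriticalBipodal_second_zero_off_diagonal_one ha h,
      not_isCriticalBipodal_off_diagonal_one ha hb h,
      not_isCriticalBipodal_first_one_off_diagonal_one h.swap,
      not_isCriticalBipodal_first_one_off_diagonal_one h,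
      not_isCriticalBipodal_first_one_off_diagonal_one h,
      not_isCriticalBipodal_first_one_off_diagonal_one h]

end EdgeTriangle

end

theorem mainTheorem1_general {V : Set (ℝ × ℝ)} (hV : EdgeTriangle.IsB21orC12Phase V) {p₀ : ℝ × ℝ}
    {a b c d : ℝ} (h : EdgeTriangle.IsB11 a b c d) :
    ¬ EdgeTriangle.IsLimitOfOptimizers V p₀ (EdgeTriangle.bipodal a b c d) := by
  intro hlim
  obtain ⟨_, _, _, _, _, _, _, _, _, _, _, hmerging⟩ :=
    EdgeTriangle.exists_isMergingSequence hV h hlim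
  exact EdgeTriangle.not_isCriticalBipodal hmerging.isCriticalBipodal

theorem mainTheorem1 :
    {ε : ℝ | ∃ (τ : ℝ) (U V : Set (ℝ × ℝ)),
      EdgeTriangle.IsB11Phase U ∧ EdgeTriangle.IsB21orC12Phase V ∧
        EdgeTriangle.IsContinuousTransition U V (ε, τ)}.Finite := by
  convert Set.finite_empty
  refine Set.eq_empty_of_forall_notMem ?_
  rintro ε ⟨τ, U, V, -, hV, a, b, c, d, hB11, -, hlim⟩
  exact mainTheorem1_general hV hB11 hlim
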